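/- Let $n\ge 1$. Write points of $\mathbb C^n$ as $x=(x_1,\dots,x_n)$ and let $a=(a_1,\dots,a_n)$ be the coordinates of the hyperplane $x_n=a_1x_1+\dots+a_{n-1}x_{n-1}+a_n$. On $\mathbb C^k$ let $\mu$ denote the Lebesgue measure divided by $(2\pi)^k$. Generalized functions are tempered distributions. The Fourier transform on $\mathbb C$ is $\tilde\psi(c)=\int_{\mathbb C}\psi(t)e^{i\,\mathrm{Re}(ct)}\,d\mu(t)$ for Schwartz functions, extended to generalized functions by $\langle\tilde u,\psi\rangle=\langle u,\tilde\psi\rangle$. A locally integrable function $g$ is identified with the functional $\psi\mapsto\int g\,\psi\,d\mu$, if the integrand is integrable for all Schwartz functions $\psi$; and $\overline u$ is defined by $\langle\overline u,\psi\rangle=\overline{\langle u,\overline\psi\rangle}$. For a generalized function $u$ on $\mathbb C$ the generalized Radon transform is $$(\mathcal R_uf)(a)=\int_{\mathbb C^n}f(x)\,u(x_n-a_1x_1-\dots-a_{n-1}x_{n-1}-a_n)\,d\mu(x),$$ that is, for a Schwartz function $f$, $u$ is applied to the Schwartz function $t\mapsto\int_{\mathbb C^{n-1}}f\bigl(y,\sum_i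 a_iy_i+a_n+t\bigr)\,d\mu(y)$ on $\mathbb C$. **Generalized Fourier transforms.** Let $X$, $Y$ be finite-dimensional real normed spaces with measures $dx$, $dy$, and let $e(x,y)$ be a kernel whose sections $e(\cdot,y)$ and $e(x,\cdot)$ are generalized functions on $X$ and $Y$. A *test space* in $L^2(X,dx)$ is a dense linear subspace of $L^2(X,dx)$ that consists of continuous functions, is an algebra under pointwise multiplication, contains the Schwartz functions, and carries a locally convex topology for which the inclusion in $L^2$ and all evaluations $f\mapsto f(x)$ are continuous. The transform $f\mapsto\hat f(y)=\int f(x)\,e(x,y)\,dx$ is a *generalized Fourier transform* (GFT) if there are a topological linear isomorphism $F:L^2(X,dx)\to L^2(Y,dy)$ and test spaces $S\subset L^2(X,dx)$, $\hat S\subset L^2(Y,dy)$ such that 1. $F$ restricts to a topological linear isomorphism $\Phi:S\to\hat S$; 2. $\int f\,\overline g\,dx=\int Ff\;\overline{Fg}\,dy$ for all $f,g\in L^2(X,dx)$; 3. $(\Phi f)(y)=\int f(x)\,e(x,y)\,dx$ for every Schwartz function $f$ on $X$ and every $y\in Y$; 4. $(\Phi^{-1}g)(x)=\int g(y)\,\overline{e(x,y)}\,dy$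 for every Schwartz function $g$ on $Y$ and every $x\in X$. **Statement.** Let $u$ be a generalized function on $\mathbb C$ whose Fourier transform $\tilde u$ is a usual (locally integrable) function with $|\tilde u(c)|=|c|^{n-1}$ for almost every $c\in\mathbb C$. Then: (i) the generalized function $$U(t)=\int_{\mathbb C}[\tilde u(c)]^{-1}|c|^{2(n-1)}e^{i\,\mathrm{Re}(ct)}\,d\mu(c),\qquad\text{i.e. } \langle U,\psi\rangle=\int_{\mathbb C}[\tilde u(c)]^{-1}|c|^{2(n-1)}\tilde\psi(c)\,d\mu(c),$$ is well defined (the integrals converge absolutely for all Schwartz functions $\psi$), and $U(t)=\overline{u(t)}$; (ii) the generalized Radon transform $\mathcal R_u$ is a generalized Fourier transform from $(\mathbb C^n,\mu)$ to $(\mathbb C^n,\mu)$ with kernel $e(x,a)=u(x_n-a_1x_1-\dots-a_{n-1}x_{n-1}-a_n)$. In particular its inverse is given by the kernel $\overline{e(x,a)}=U(x_n-a_1x_1-\dots-a_{n-1}x_{n-1}-a_n)$. -/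

import Mathlib

open MeasureTheory SchwartzMap
open scoped ComplexConjugate

/-! ## Normalized measures and the Fourier transform on `ℂ` -/

/-- The Lebesgue measure on `ℂ` divided by `2π`. It is self-dual for the character
`exp (i Re (c t))`, so no constants are left in the Fourier inversion formula. -/
noncomputable def cMeasure : Measure ℂ :=
  ENNReal.ofReal ((2 * Real.pi)⁻¹) • volume

/-- The product measure on `ℂ ^ k` of `k` copies of `cMeasure`,
that is, the Lebesgue measure divided by `(2π) ^ k`. -/
noncomputable def cnMeasure (k : ℕ) : Measure (Fin k → ℂ) :=
  ENNReal.ofReal ((2 * Real.pi)⁻¹ ^ k) • volume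

instance cnMeasure_isAddHaarMeasure (k : ℕ) : (cnMeasure k).IsAddHaarMeasure :=
  Measure.IsAddHaarMeasure.smul volume
    (by have := Real.pi_pos; simpa using by positivity) ENNReal.ofReal_ne_top

/-- The real linear automorphism `t ↦ - conj t / (2π)` of `ℂ`. -/
noncomputable def dualScaling : ℂ ≃L[ℝ] ℂ :=
  Complex.conjCLE.trans
    (ContinuousLinearEquiv.smulLeft
      (Units.mk0 (-(2 * Real.pi)⁻¹ : ℝ) (by have := Real.pi_pos; simp [this.ne'])))

/-- The Fourier transform on `𝓢(ℂ, ℂ)`, `ψ ↦ (t ↦ ∫ ψ(c) exp (i Re (c t)) dν(c))` with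
`ν = cMeasure`; see `cFourier_apply`. -/
noncomputable def cFourier : 𝓢(ℂ, ℂ) →L[ℂ] 𝓢(ℂ, ℂ) :=
  ((2 * Real.pi)⁻¹ : ℂ) • (compCLMOfContinuousLinearEquiv ℂ dualScaling).comp
    (FourierTransform.fourierCLM ℂ 𝓢(ℂ, ℂ))

theorem cFourier_apply (ψ : 𝓢(ℂ, ℂ)) (t : ℂ) :
    cFourier ψ t = ∫ c, ψ c * Complex.exp (Complex.I * ((c * t).re : ℂ)) ∂cMeasure := by
  have hπ := Real.pi_pos
  have h : cFourier ψ t = ((2 * Real.pi)⁻¹ : ℂ) * FourierTransform.fourier (ψ : ℂ → ℂ)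
      (dualScaling t) := rfl
  rw [h, cMeasure, integral_smul_measure, Real.fourier_eq',
    ENNReal.toReal_ofReal (by positivity), Complex.real_smul]
  push_cast
  congr 1
  refine integral_congr_ae (Filter.Eventually.of_forall fun c => ?_)
  have h1 : inner ℝ c (dualScaling t) = -(2 * Real.pi)⁻¹ * (c * t).re := by
    change inner ℝ c ((-(2 * Real.pi)⁻¹ : ℝ) • conj t) = _
    rw [inner_smul_right, Complex.inner]
    simp only [Complex.mul_re, Complex.conj_re, Complex.conj_im]
    ring
  have h2 : -2 * Real.pi * (-(2 * Real.pi)⁻¹ * (c * t).re) = (c * t).re := by field_simp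
  simp only [smul_eq_mul]
  rw [h1, mul_comm, mul_comm Complex.I]
  congr 3
  exact_mod_cast h2

/-! ## Generalized functions -/

/-- Complex conjugation of Schwartz functions. -/
noncomputable def schwartzConj {E : Type*} [NormedAddCommGroup E] [NormedSpace ℝ E] :
    𝓢(E, ℂ) →L[ℝ] 𝓢(E, ℂ) :=
  postcompCLM (Complex.conjCLE : ℂ →L[ℝ] ℂ)

/-- The complex conjugate of a generalized function: `⟨conj u, ψ⟩ = conj ⟨u, conj ψ⟩`. -/
noncomputable def distConj {E : Type*} [NormedAddCommGroup E] [NormedSpace ℝ E]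
    (u : 𝓢'(E, ℂ)) : 𝓢'(E, ℂ) :=
  { toFun := fun ψ => conj (u (schwartzConj ψ))
    map_add' := by intro f g; simp
    map_smul' := by
      intro a f
      have : schwartzConj (a • f) = conj a • schwartzConj f := by
        ext x; simp [schwartzConj]
      simp [this]
    cont := Complex.continuous_conj.comp (u.cont.comp schwartzConj.cont) }

theorem distConj_apply {E : Type*} [NormedAddCommGroup E] [NormedSpace ℝ E]
    (u : 𝓢'(E, ℂ)) (ψ : 𝓢(E, ℂ)) : distConj u ψ = conj (u (schwartzConj ψ)) := rfl

/-- The Fourier transform of the generalized function `u` on `ℂ` (defined by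
`⟨ũ, ψ⟩ = ⟨u, ψ̃⟩`) is the usual function `w`. -/
def HasFourierFunction (u : 𝓢'(ℂ, ℂ)) (w : ℂ → ℂ) : Prop :=
  LocallyIntegrable w cMeasure ∧
    ∀ ψ : 𝓢(ℂ, ℂ), Integrable (fun c => w c * ψ c) cMeasure ∧
      u (cFourier ψ) = ∫ c, w c * ψ c ∂cMeasure

/-- The generalized function `U` on `ℂ` is `U(t) = ∫ g(c) exp (i Re (c t)) dν(c)`,
in the sense of generalized functions. -/
def IsFourierIntegral (U : 𝓢'(ℂ, ℂ)) (g : ℂ → ℂ) : Prop :=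
  ∀ ψ : 𝓢(ℂ, ℂ), Integrable (fun c => g c * cFourier ψ c) cMeasure ∧
    U ψ = ∫ c, g c * cFourier ψ c ∂cMeasure

/-! ## Integration of a Schwartz function over part of the variables -/

section PartialIntegral

set_option linter.unusedSectionVars false

universe v

variable {D : Type*} {T : Type} {V : Type v} [NormedAddCommGroup D] [NormedSpace ℝ D] [MeasurableSpace D]
  [BorelSpace D] [SecondCountableTopology D] [NormedAddCommGroup T] [NormedSpace ℝ T]
  [NormedAddCommGroup V] [NormedSpace ℝ V]

theorem schwartz_partial_bound (𝕜 : Type*) [NormedField 𝕜] [NormedSpace 𝕜 V] [SMulCommClass ℝ 𝕜 V]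
    (G : 𝓢(D × T, V)) (k l n : ℕ) (y : D) (t : T) :
    ‖t‖ ^ k * ‖iteratedFDeriv ℝ n G (y, t)‖ ≤ (1 + ‖y‖) ^ (-(l : ℝ)) *
      (2 ^ (k + l) * (Finset.Iic (k + l, n)).sup (schwartzSeminormFamily 𝕜 (D × T) V) G) := by
  have h := one_add_le_sup_seminorm_apply (𝕜 := 𝕜) (m := (k + l, n)) (k := k + l) (n := n)
    le_rfl le_rfl G (y, t)
  rw [Real.rpow_neg (by positivity), ← div_eq_inv_mul, le_div_iff₀' (by positivity),
    Real.rpow_natCast]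
  refine le_trans ?_ h
  have h1 : ‖y‖ ≤ ‖(y, t)‖ := norm_fst_le (y, t)
  have h2 : ‖t‖ ≤ 1 + ‖(y, t)‖ := (norm_snd_le (y, t)).trans (by simp)
  rw [← mul_assoc, pow_add, mul_comm ((1 + ‖(y, t)‖) ^ k)]
  gcongr

theorem schwartz_partial_integrable (μ : Measure D) [μ.HasTemperateGrowth]
    (G : 𝓢(D × T, V)) (n : ℕ) (t : T) :
    Integrable (fun y => iteratedFDeriv ℝ n G (y, t)) μ := by
  obtain ⟨l, hl⟩ := ‹μ.HasTemperateGrowth›.exists_integrable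
  refine (hl.mul_const (2 ^ (0 + l) * (Finset.Iic (0 + l, n)).sup
    (schwartzSeminormFamily ℝ (D × T) V) G)).mono' ?_ (Filter.Eventually.of_forall fun y => ?_)
  · exact (((G.smooth ⊤).continuous_iteratedFDeriv (mod_cast le_top)).comp
      (Continuous.prodMk_left t)).aestronglyMeasurable
  · simpa using schwartz_partial_bound ℝ G 0 l n y t

theorem schwartz_partial_integrable_zero (μ : Measure D) [μ.HasTemperateGrowth]
    (G : 𝓢(D × T, V)) (t : T) : Integrable (fun y => G (y, t)) μ := by
  obtain ⟨l, hl⟩ := ‹μ.HasTemperateGrowth›.exists_integrable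
  refine (hl.mul_const (2 ^ (0 + l) * (Finset.Iic (0 + l, 0)).sup
    (schwartzSeminormFamily ℝ (D × T) V) G)).mono' ?_ (Filter.Eventually.of_forall fun y => ?_)
  · exact (G.continuous.comp (Continuous.prodMk_left t)).aestronglyMeasurable
  · simpa using schwartz_partial_bound ℝ G 0 l 0 y t

/-- The partial derivative of a Schwartz function in the second variable. -/
noncomputable def partialDeriv (G : 𝓢(D × T, V)) : 𝓢(D × T, T →L[ℝ] V) :=
  postcompCLM ((ContinuousLinearMap.compL ℝ T (D × T) V).flip (ContinuousLinearMap.inr ℝ D T))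
    (fderivCLM ℝ (D × T) V G)

theorem norm_iteratedFDeriv_partialDeriv_le (G : 𝓢(D × T, V)) (n : ℕ) (p : D × T) :
    ‖iteratedFDeriv ℝ n (partialDeriv G) p‖ ≤ ‖iteratedFDeriv ℝ (n + 1) G p‖ := by
  set L := (ContinuousLinearMap.compL ℝ T (D × T) V).flip (ContinuousLinearMap.inr ℝ D T)
  have hL : ‖L‖ ≤ 1 := by
    refine ContinuousLinearMap.opNorm_le_bound _ zero_le_one fun A => ?_
    rw [one_mul]
    refine ContinuousLinearMap.opNorm_le_bound _ (norm_nonneg _) fun t => ?_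
    refine (A.le_opNorm _).trans ?_
    gcongr
    simp
  have h1 : (partialDeriv G : D × T → T →L[ℝ] V) = L ∘ fderiv ℝ G := rfl
  have hG : ContDiff ℝ n (fderiv ℝ G) := (fderivCLM ℝ (D × T) V G).smooth n
  rw [h1, L.iteratedFDeriv_comp_left hG.contDiffAt le_rfl]
  refine (L.norm_compContinuousMultilinearMap_le _).trans ?_
  rw [norm_iteratedFDeriv_fderiv]
  exact mul_le_of_le_one_left (norm_nonneg _) hL

theorem hasFDerivAt_partialIntegral (μ : Measure D) [μ.HasTemperateGrowth]
    (G : 𝓢(D × T, V)) (t : T) :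
    HasFDerivAt (fun t => ∫ y, G (y, t) ∂μ) (∫ y, partialDeriv G (y, t) ∂μ) t := by
  obtain ⟨l, hl⟩ := ‹μ.HasTemperateGrowth›.exists_integrable
  refine hasFDerivAt_integral_of_dominated_of_fderiv_le (s := Set.univ)
    (F' := fun t y => partialDeriv G (y, t)) Filter.univ_mem
    (Filter.Eventually.of_forall fun s => (schwartz_partial_integrable_zero μ G s).1)
    (schwartz_partial_integrable_zero μ G t)
    (schwartz_partial_integrable_zero μ (partialDeriv G) t).1
    (Filter.Eventually.of_forall fun y s _ => ?_)
    (hl.mul_const (2 ^ (0 + l) * (Finset.Iic (0 + l, 0)).sup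
      (schwartzSeminormFamily ℝ (D × T) (T →L[ℝ] V)) (partialDeriv G)))
    (Filter.Eventually.of_forall fun y s _ => ?_)
  · simpa using schwartz_partial_bound ℝ (partialDeriv G) 0 l 0 y s
  · exact (G.hasFDerivAt (y, s)).comp s (hasFDerivAt_prodMk_right y s)

theorem partialIntegral_aux (μ : Measure D) [μ.HasTemperateGrowth] (n : ℕ) :
    ∀ {V : Type v} [NormedAddCommGroup V] [NormedSpace ℝ V] (G : 𝓢(D × T, V)),
      ContDiff ℝ n (fun t => ∫ y, G (y, t) ∂μ) ∧
      ∀ t, ‖iteratedFDeriv ℝ n (fun t => ∫ y, G (y, t) ∂μ) t‖ ≤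
        ∫ y, ‖iteratedFDeriv ℝ n G (y, t)‖ ∂μ := by
  induction n with
  | zero =>
    intro V _ _ G
    refine ⟨contDiff_zero.2 (continuous_iff_continuousAt.2 fun t =>
      (hasFDerivAt_partialIntegral μ G t).continuousAt), fun t => ?_⟩
    simpa using norm_integral_le_integral_norm (μ := μ) fun y => G (y, t)
  | succ n ih =>
    intro V _ _ G
    obtain ⟨h1, h2⟩ := ih (partialDeriv G)
    have hd : fderiv ℝ (fun t => ∫ y, G (y, t) ∂μ) = fun t => ∫ y, partialDeriv G (y, t) ∂μ :=
      funext fun t => (hasFDerivAt_partialIntegral μ G t).fderiv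
    refine ⟨?_, fun t => ?_⟩
    · push_cast
      refine contDiff_succ_iff_fderiv.2
        ⟨fun t => (hasFDerivAt_partialIntegral μ G t).differentiableAt, by simp, ?_⟩
      rw [hd]
      exact h1
    · rw [← norm_iteratedFDeriv_fderiv, hd]
      refine (h2 t).trans (integral_mono (schwartz_partial_integrable μ _ n t).norm
        (schwartz_partial_integrable μ G (n + 1) t).norm fun y => ?_)
      exact norm_iteratedFDeriv_partialDeriv_le G n (y, t)

/-- Integration over the first variable, `G ↦ (t ↦ ∫ G(y, t) dμ(y))`, on Schwartz functions. -/
noncomputable def partialIntegral (μ : Measure D) [μ.HasTemperateGrowth] :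
    𝓢(D × T, ℂ) →L[ℂ] 𝓢(T, ℂ) :=
  mkCLM (fun G t => ∫ y, G (y, t) ∂μ)
    (fun G H t => integral_add (schwartz_partial_integrable_zero μ G t)
      (schwartz_partial_integrable_zero μ H t))
    (fun a G t => integral_const_mul a fun y => G (y, t))
    (fun G => contDiff_infty.2 fun n => (partialIntegral_aux μ n G).1)
    (by
      rintro ⟨k, n⟩
      obtain ⟨l, hl⟩ := ‹μ.HasTemperateGrowth›.exists_integrable
      refine ⟨Finset.Iic (k + l, n), (∫ y, (1 + ‖y‖) ^ (-(l : ℝ)) ∂μ) * 2 ^ (k + l),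
        mul_nonneg (integral_nonneg fun y => by positivity) (by positivity), fun G t => ?_⟩
      have h := (partialIntegral_aux μ n G).2 t
      calc ‖t‖ ^ k * ‖iteratedFDeriv ℝ n (fun t => ∫ y, G (y, t) ∂μ) t‖
          ≤ ‖t‖ ^ k * ∫ y, ‖iteratedFDeriv ℝ n G (y, t)‖ ∂μ := by gcongr
        _ = ∫ y, ‖t‖ ^ k * ‖iteratedFDeriv ℝ n G (y, t)‖ ∂μ := (integral_const_mul _ _).symm
        _ ≤ ∫ y, (1 + ‖y‖) ^ (-(l : ℝ)) * (2 ^ (k + l) *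
              (Finset.Iic (k + l, n)).sup (schwartzSeminormFamily ℂ (D × T) ℂ) G) ∂μ :=
            integral_mono ((schwartz_partial_integrable μ G n t).norm.const_mul _)
              (hl.mul_const _) fun y => schwartz_partial_bound ℂ G k l n y t
        _ = _ := by rw [integral_mul_const, mul_assoc])

theorem partialIntegral_apply (μ : Measure D) [μ.HasTemperateGrowth] (G : 𝓢(D × T, ℂ)) (t : T) :
    partialIntegral μ G t = ∫ y, G (y, t) ∂μ := rfl

end PartialIntegral

/-! ## The generalized Radon transform on `ℂ ^ (m + 1)` -/

/-- The linear coordinates `(y, t) ↦ (y, ∑ pᵢ yᵢ + σ t)` on `ℂ ^ (m + 1)`. -/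
noncomputable def shear {m : ℕ} (σ : ℂˣ) (p : Fin m → ℂ) :
    ((Fin m → ℂ) × ℂ) ≃L[ℝ] (Fin (m + 1) → ℂ) :=
  LinearEquiv.toContinuousLinearEquiv
    { toFun := fun (q : (Fin m → ℂ) × ℂ) =>
        (Fin.snoc q.1 (∑ i, p i * q.1 i + σ * q.2) : Fin (m + 1) → ℂ)
      invFun := fun x => (fun i => x i.castSucc,
        (σ⁻¹ : ℂˣ) * (x (Fin.last m) - ∑ i, p i * x i.castSucc))
      map_add' := by
        intro q r
        funext j
        refine Fin.lastCases ?_ (fun i => ?_) j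
        · simp [mul_add, Finset.sum_add_distrib]; ring
        · simp
      map_smul' := by
        intro a q
        funext j
        refine Fin.lastCases ?_ (fun i => ?_) j
        · simp [Finset.mul_sum, mul_left_comm, mul_add]
        · simp
      left_inv := by
        intro q
        simp
      right_inv := by
        intro x
        funext j
        refine Fin.lastCases ?_ (fun i => ?_) j
        · simp
        · simp }

/-- Integrals over parallel hyperplanes:
`f ↦ (t ↦ ∫ f(y, ∑ pᵢ yᵢ + s + σ t) dν(y))`, `y ∈ ℂ ^ m`; see `planeIntegral_apply`. -/
noncomputable def planeIntegral {m : ℕ} (σ : ℂˣ) (p : Fin m → ℂ) (s : ℂ) :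
    𝓢(Fin (m + 1) → ℂ, ℂ) →L[ℂ] 𝓢(ℂ, ℂ) :=
  (partialIntegral (cnMeasure m)).comp ((compCLMOfContinuousLinearEquiv ℂ (shear σ p)).comp
    (compSubConstCLM ℂ (-(Fin.snoc (0 : Fin m → ℂ) s : Fin (m + 1) → ℂ))))

theorem planeIntegral_apply {m : ℕ} (σ : ℂˣ) (p : Fin m → ℂ) (s : ℂ)
    (f : 𝓢(Fin (m + 1) → ℂ, ℂ)) (t : ℂ) :
    planeIntegral σ p s f t =
      ∫ y, f (Fin.snoc y (∑ i, p i * y i + s + σ * t)) ∂(cnMeasure m) := by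
  have h : planeIntegral σ p s f t = ∫ y, f ((Fin.snoc y (∑ i, p i * y i + σ * t) :
      Fin (m + 1) → ℂ) - -(Fin.snoc (0 : Fin m → ℂ) s : Fin (m + 1) → ℂ)) ∂(cnMeasure m) := rfl
  rw [h]
  congr 1
  funext y
  congr 1
  funext j
  refine Fin.lastCases ?_ (fun i => ?_) j
  · simp; ring
  · simp

/-- For a generalized function `u` on `ℂ`, the generalized function
`x ↦ u(xₙ - a₁ x₁ - ⋯ - aₙ₋₁ xₙ₋₁ - aₙ)` on `ℂ ^ n`, `n = m + 1`. On a test function `f` it is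
obtained by integrating `f` over the hyperplanes `xₙ - a₁ x₁ - ⋯ - aₙ₋₁ xₙ₋₁ - aₙ = t` and applying
`u` in the variable `t`. -/
noncomputable def radonKernelX {m : ℕ} (u : 𝓢'(ℂ, ℂ)) (a : Fin (m + 1) → ℂ) :
    𝓢'(Fin (m + 1) → ℂ, ℂ) :=
  PointwiseConvergenceCLM.precomp ℂ
    (planeIntegral 1 (fun i => a i.castSucc) (a (Fin.last m))) u

/-- The same kernel `u(xₙ - a₁ x₁ - ⋯ - aₙ₋₁ xₙ₋₁ - aₙ)` as a generalized function of `a` for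
fixed `x`. -/
noncomputable def radonKernelA {m : ℕ} (u : 𝓢'(ℂ, ℂ)) (x : Fin (m + 1) → ℂ) :
    𝓢'(Fin (m + 1) → ℂ, ℂ) :=
  PointwiseConvergenceCLM.precomp ℂ
    (planeIntegral (-1) (fun i => -x i.castSucc) (x (Fin.last m))) u

/-! ## Generalized Fourier transforms -/

section GFT

variable {X Y : Type*} [NormedAddCommGroup X] [NormedSpace ℝ X] [MeasurableSpace X]
  [NormedAddCommGroup Y] [NormedSpace ℝ Y] [MeasurableSpace Y]

/-- A test space `S` in `L²(X, dx)`: a dense linear subspace that consists of continuous functions,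
is an algebra under multiplication of functions, contains the Schwartz functions, and has a
locally convex topology for which the inclusion in `L²` and the `δ`-functions are continuous. -/
structure TestAlgebra (μ : Measure X) where
  carrier : NonUnitalSubalgebra ℂ (X → ℂ)
  topology : TopologicalSpace carrier
  isTopologicalAddGroup : IsTopologicalAddGroup carrier
  continuousSMul : ContinuousSMul ℂ carrier
  locallyConvex : LocallyConvexSpace ℝ carrier
  continuous_of_mem : ∀ f ∈ carrier, Continuous f
  memLp : ∀ f ∈ carrier, MemLp f 2 μ
  dense : Dense {F : Lp ℂ 2 μ | ∃ f ∈ carrier, F =ᵐ[μ] f}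
  schwartz_mem : ∀ f : 𝓢(X, ℂ), (f : X → ℂ) ∈ carrier
  continuous_toLp : Continuous fun f : carrier => (memLp f f.2).toLp (f : X → ℂ)
  continuous_eval : ∀ x : X, Continuous fun f : carrier => (f : X → ℂ) x

instance TestAlgebra.instTopologicalSpace {μ : Measure X} (S : TestAlgebra μ) :
    TopologicalSpace S.carrier := S.topology

/-- The integral transform `f ↦ f̂`, `f̂(y) = ∫ f(x) e(x, y) dx`, is a generalized Fourier transform
from `X` to `Y`. The kernel `e` is given by its sections `eX y = e(·, y)` and `eY x = e(x, ·)`, which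
are generalized functions on `X` and on `Y`.

There are test spaces `S ⊆ L²(X)` and `S' ⊆ L²(Y)` and an isomorphism `F : L²(X) → L²(Y)` that
restricts to an isomorphism `Φ : S → S'`. It satisfies the Plancherel formula, it is given by the
kernel `e` on the Schwartz functions on `X`, and its inverse is given by the kernel `conj e` on the
Schwartz functions on `Y`. -/
def IsGeneralizedFourierTransform (μ : Measure X) (ν : Measure Y)
    (eX : Y → 𝓢'(X, ℂ)) (eY : X → 𝓢'(Y, ℂ)) : Prop :=
  ∃ (F : Lp ℂ 2 μ ≃L[ℂ] Lp ℂ 2 ν) (S : TestAlgebra μ) (S' : TestAlgebra ν)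
    (Φ : S.carrier ≃L[ℂ] S'.carrier),
    (∀ f : S.carrier, F ((S.memLp f f.2).toLp f) = (S'.memLp (Φ f) (Φ f).2).toLp (Φ f)) ∧
    (∀ f g : Lp ℂ 2 μ, ∫ x, f x * conj (g x) ∂μ = ∫ y, F f y * conj (F g y) ∂ν) ∧
    (∀ (f : 𝓢(X, ℂ)) (y : Y), (Φ ⟨f, S.schwartz_mem f⟩ : Y → ℂ) y = eX y f) ∧
    (∀ (g : 𝓢(Y, ℂ)) (x : X), (Φ.symm ⟨g, S'.schwartz_mem g⟩ : X → ℂ) x = distConj (eY x) g)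

end GFT

/-! Put `m = n - 1`, and write a test function as the Fourier transform of a symbol `h(c, ξ)`, with
`c` dual to the last coordinate and `ξ` to the others. By the projection-slice theorem
(`integral_schwartzFourier_hyperplane`) its integrals over the hyperplanes with slope `b` and
intercept `s + t` are, as a function of `t`, the Fourier transform of `c ↦ h(c, -c b) e(c s)`, where
`e(z) = exp(i Re z)`. Hence applying `u` gives `∫ ũ(c) h(c, -c b) e(c s) dν(c)`.

In terms of symbols this operator is `radonMul`: with `ĥ` the Fourier transform of `h` in `ξ` alone
(`fiberFourier`), `h` goes to `w(c) |c|^(-2m) ĥ(c, ε c⁻¹ η)`, with `w = ũ` and `ε = 1`. The dilation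
by `ε c⁻¹` of `ℂ ^ m` has Jacobian `|c|^(-2m)`, so the hypothesis `|w| = |c|^m` makes the operator
an `L²` isometry on almost every fibre (`eLpNorm_radonMul`). Its inverse is the same operator with
`conj w` and `ε = -1`, because `conj w * w = |c|^(2m)` and a repeated Fourier transform is a
reflection (`RadonAdmissible.radonMul_conj_radonMul`).

Both test spaces consist of the Fourier transforms of symbols `h` in `L¹ ∩ L²` with `|c|^m ĥ` in
`L¹`. The operator interchanges the two `L¹` conditions, so the space is invariant. It is an algebra
because convolution of symbols preserves these conditions
(`RadonAdmissible.exists_splitFourier_mul`), and it contains the Schwartz functions because `ĥ` is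
then rapidly decreasing in the fibre variable (`radonAdmissible_schwartz`). The topology is the
coarsest that controls the `L²` class and the point values of both a function and its transform. The
claim about `U` reduces to `w⁻¹ |c|^(2m) = conj w` almost everywhere. -/

/-! ## The Fourier transform on `ℂ ^ k` -/

/-- The identification of `ℂ ^ k` with the Euclidean space, over the reals. -/
noncomputable def toEuclid (k : ℕ) : (Fin k → ℂ) ≃L[ℝ] EuclideanSpace ℂ (Fin k) :=
  (PiLp.continuousLinearEquiv 2 ℝ fun _ : Fin k => ℂ).symm

theorem toEuclid_apply (k : ℕ) (x : Fin k → ℂ) (i : Fin k) : toEuclid k x i = x i := rfl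

theorem integral_exp_neg_pi_mul_sq_norm {V : Type*} [NormedAddCommGroup V] [InnerProductSpace ℝ V]
    [FiniteDimensional ℝ V] [MeasurableSpace V] [BorelSpace V] :
    ∫ v : V, Real.exp (-Real.pi * ‖v‖ ^ 2) = 1 := by
  rw [GaussianFourier.integral_rexp_neg_mul_sq_norm Real.pi_pos, div_self Real.pi_pos.ne',
    Real.one_rpow]

/-- The image measure is a Haar measure, hence a multiple of the volume. The multiple is found by
testing on the Gaussian `exp (-π |v|²)`, which has integral 1 in every dimension and factors over
the coordinates. -/
theorem measurePreserving_toEuclid (k : ℕ) : MeasurePreserving (toEuclid k) volume volume := by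
  have hm : Measurable (toEuclid k) := (toEuclid k).continuous.measurable
  let T : (Fin k → ℂ) ≃ᵐ EuclideanSpace ℂ (Fin k) :=
    (toEuclid k).toHomeomorph.toMeasurableEquiv
  set μ : Measure (EuclideanSpace ℂ (Fin k)) := Measure.map (toEuclid k) volume with hμ
  have : μ.IsAddHaarMeasure :=
    (toEuclid k).isAddHaarMeasure_map volume
  have h1 := Measure.isAddLeftInvariant_eq_smul μ volume
  set c := μ.addHaarScalarFactor volume
  have h2 : ∫ v, Real.exp (-Real.pi * ‖v‖ ^ 2) ∂μ = 1 := by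
    have : μ = Measure.map T volume := rfl
    rw [this, integral_map_equiv]
    have h3 : ∀ x : Fin k → ℂ, Real.exp (-Real.pi * ‖T x‖ ^ 2) =
        ∏ i, Real.exp (-Real.pi * ‖x i‖ ^ 2) := by
      intro x
      rw [← Real.exp_sum, ← Finset.mul_sum, EuclideanSpace.norm_sq_eq]
      rfl
    simp_rw [h3]
    rw [integral_fintype_prod_volume_eq_prod (fun (_ : Fin k) (z : ℂ) =>
      Real.exp (-Real.pi * ‖z‖ ^ 2))]
    simp only [integral_exp_neg_pi_mul_sq_norm, Finset.prod_const_one]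
  rw [h1, integral_smul_nnreal_measure, integral_exp_neg_pi_mul_sq_norm] at h2
  have hc : c = 1 := by
    rw [NNReal.smul_def] at h2
    have : (c : ℝ) = 1 := by simpa using h2
    exact_mod_cast this
  refine ⟨hm, ?_⟩
  rw [← hμ, h1, hc, one_smul]

/-- Complex conjugation on `ℂ ^ k`. -/
noncomputable def piConj (k : ℕ) : (Fin k → ℂ) ≃L[ℝ] (Fin k → ℂ) :=
  ContinuousLinearEquiv.piCongrRight fun _ => Complex.conjCLE

theorem measurePreserving_piConj (k : ℕ) : MeasurePreserving (piConj k) volume volume :=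
  volume_preserving_pi fun _ => Complex.conjLIE.measurePreserving

/-- The real linear automorphism `y ↦ - conj y / (2π)`, followed by `toEuclid`. -/
noncomputable def euclidDual (k : ℕ) : (Fin k → ℂ) ≃L[ℝ] EuclideanSpace ℂ (Fin k) :=
  ((piConj k).trans (toEuclid k)).trans
    (ContinuousLinearEquiv.smulLeft
      (Units.mk0 (-(2 * Real.pi)⁻¹ : ℝ) (by have := Real.pi_pos; simp [this.ne'])))

theorem euclidDual_apply (k : ℕ) (y : Fin k → ℂ) :
    euclidDual k y = (-(2 * Real.pi)⁻¹ : ℝ) • toEuclid k (piConj k y) := rfl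

theorem integral_comp_euclidDual (k : ℕ) (g : EuclideanSpace ℂ (Fin k) → ℂ) :
    ∫ y, g (euclidDual k y) = ((2 * Real.pi) ^ (2 * k) : ℝ) • ∫ v, g v := by
  have hmp : MeasurePreserving (fun y => toEuclid k (piConj k y)) volume volume :=
    (measurePreserving_toEuclid k).comp (measurePreserving_piConj k)
  have hemb : MeasurableEmbedding (fun y => toEuclid k (piConj k y)) :=
    ((piConj k).trans (toEuclid k)).toHomeomorph.measurableEmbedding
  have h := hmp.integral_comp hemb (fun v => g ((-(2 * Real.pi)⁻¹ : ℝ) • v))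
  simp only [euclidDual_apply]
  rw [h, Measure.integral_comp_smul]
  have hd : Module.finrank ℝ (EuclideanSpace ℂ (Fin k)) = 2 * k := by
    rw [← (toEuclid k).toLinearEquiv.finrank_eq, Module.finrank_pi_fintype]
    simp [Complex.finrank_real_complex, mul_comm]
  rw [hd, (even_two_mul k).neg_pow, inv_pow, inv_inv, abs_of_nonneg (by positivity)]

/-- Conjugation turns the Euclidean inner product into the real part of the bilinear pairing, and
the factor `-(2π)⁻¹` absorbs the `-2π` in the exponent of Mathlib's Fourier transform. -/
theorem inner_euclidDual (k : ℕ) (ξ y : Fin k → ℂ) :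
    inner ℝ (toEuclid k ξ) (euclidDual k y) = -(2 * Real.pi)⁻¹ * (ξ ⬝ᵥ y).re := by
  rw [euclidDual_apply, inner_smul_right]
  congr 1
  rw [PiLp.inner_apply, dotProduct, Complex.re_sum]
  refine Finset.sum_congr rfl fun i _ => ?_
  have h1 : toEuclid k (piConj k y) i = conj (y i) := rfl
  rw [toEuclid_apply, h1]
  simp [Complex.inner, mul_comm]

/-! ### The self-dual Fourier transform on Schwartz functions -/

/-- The character `exp (i Re z)` of `ℂ`. -/
noncomputable def eiRe (z : ℂ) : ℂ := Complex.exp (Complex.I * (z.re : ℂ))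

theorem eiRe_add (z w : ℂ) : eiRe (z + w) = eiRe z * eiRe w := by
  simp [eiRe, mul_add, Complex.exp_add]

@[simp] theorem eiRe_zero : eiRe 0 = 1 := by simp [eiRe]

@[simp] theorem norm_eiRe (z : ℂ) : ‖eiRe z‖ = 1 := by
  rw [eiRe, mul_comm, Complex.norm_exp_ofReal_mul_I]

theorem conj_eiRe (z : ℂ) : conj (eiRe z) = eiRe (-z) := by
  simp [eiRe, ← Complex.exp_conj]

@[fun_prop] theorem continuous_eiRe : Continuous eiRe := by unfold eiRe; fun_prop

/-- The Fourier transform `y ↦ ∫ h(ξ) exp (i Re (ξ y)) dμ(ξ)` on `ℂ ^ k`. -/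
noncomputable def piFourier {k : ℕ} (h : (Fin k → ℂ) → ℂ) (y : Fin k → ℂ) : ℂ :=
  ∫ ξ, h ξ * eiRe (ξ ⬝ᵥ y) ∂cnMeasure k

/-- The Fourier transform on `𝓢(ℂ ^ k, ℂ)`. -/
noncomputable def schwartzFourier (k : ℕ) : 𝓢(Fin k → ℂ, ℂ) →L[ℂ] 𝓢(Fin k → ℂ, ℂ) :=
  ((2 * Real.pi)⁻¹ ^ k : ℂ) • (compCLMOfContinuousLinearEquiv ℂ (euclidDual k)).comp
    ((FourierTransform.fourierCLM ℂ 𝓢(EuclideanSpace ℂ (Fin k), ℂ)).comp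
      (compCLMOfContinuousLinearEquiv ℂ (toEuclid k).symm))

theorem integral_cnMeasure {E : Type*} [NormedAddCommGroup E] [NormedSpace ℝ E] (k : ℕ)
    (g : (Fin k → ℂ) → E) :
    ∫ x, g x ∂cnMeasure k = ((2 * Real.pi)⁻¹ ^ k : ℝ) • ∫ x, g x := by
  have hπ := Real.pi_pos
  rw [cnMeasure, integral_smul_measure, ENNReal.toReal_ofReal (by positivity)]

theorem schwartzFourier_apply {k : ℕ} (φ : 𝓢(Fin k → ℂ, ℂ)) (y : Fin k → ℂ) :
    schwartzFourier k φ y = piFourier φ y := by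
  have hπ := Real.pi_pos
  have h : schwartzFourier k φ y = ((2 * Real.pi)⁻¹ ^ k : ℂ) *
      FourierTransform.fourier (φ ∘ (toEuclid k).symm) (euclidDual k y) := rfl
  rw [h, piFourier, integral_cnMeasure, Real.fourier_eq', Complex.real_smul,
    ← (measurePreserving_toEuclid k).integral_comp
      (toEuclid k).toHomeomorph.measurableEmbedding]
  congr 1
  · push_cast; rfl
  refine integral_congr_ae (Filter.Eventually.of_forall fun ξ => ?_)
  simp only [Function.comp_apply, ContinuousLinearEquiv.symm_apply_apply, inner_euclidDual,
    smul_eq_mul, eiRe]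
  have h2 : -2 * Real.pi * (-(2 * Real.pi)⁻¹ * (ξ ⬝ᵥ y).re) = (ξ ⬝ᵥ y).re := by field_simp
  rw [h2, mul_comm, mul_comm Complex.I]

theorem schwartzFourier_schwartzFourier {k : ℕ} (φ : 𝓢(Fin k → ℂ, ℂ)) (y : Fin k → ℂ) :
    schwartzFourier k (schwartzFourier k φ) y = φ (-y) := by
  have hπ := Real.pi_pos
  set ψ : 𝓢(EuclideanSpace ℂ (Fin k), ℂ) :=
    compCLMOfContinuousLinearEquiv ℂ (toEuclid k).symm φ
  have h1 : ∀ ξ, schwartzFourier k φ ξ = ((2 * Real.pi)⁻¹ ^ k : ℂ) *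
      (FourierTransform.fourier ψ) (euclidDual k ξ) := fun ξ => rfl
  have h2 : φ (-y) = ψ (toEuclid k (-y)) := by
    change _ = φ _
    simp
  have h3 : ψ = FourierTransformInv.fourierInv (FourierTransform.fourier ψ) := by simp
  rw [h2, h3, schwartzFourier_apply, piFourier, integral_cnMeasure]
  rw [fourierInv_coe, Real.fourierInv_eq']
  have h4 : ∀ ξ, schwartzFourier k φ ξ * eiRe (ξ ⬝ᵥ y) =
      (fun v => ((2 * Real.pi)⁻¹ ^ k : ℂ) * (Complex.exp (↑(2 * Real.pi *
        inner ℝ v (toEuclid k (-y))) * Complex.I) • (FourierTransform.fourier ψ) v))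
        (euclidDual k ξ) := by
    intro ξ
    have h5 : 2 * Real.pi * inner ℝ (euclidDual k ξ) (toEuclid k (-y)) = (ξ ⬝ᵥ y).re := by
      rw [map_neg, inner_neg_right, real_inner_comm, inner_euclidDual, dotProduct_comm]
      field_simp
    simp only [h5, h1, eiRe, smul_eq_mul]
    ring_nf
  simp_rw [h4]
  rw [integral_comp_euclidDual k (fun v => ((2 * Real.pi)⁻¹ ^ k : ℂ) * (Complex.exp (↑(2 * Real.pi *
        inner ℝ v (toEuclid k (-y))) * Complex.I) • (FourierTransform.fourier ψ) v)),
    integral_const_mul]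
  simp only [Complex.real_smul, ← mul_assoc]
  -- The two normalizing factors `(2π)⁻ᵏ` cancel the Jacobian of `euclidDual` in real dimension
  -- `2k`; this is the self-duality of the measure.
  have h6 : ((2 * Real.pi)⁻¹ ^ k : ℝ) * ((2 * Real.pi) ^ (2 * k) : ℝ) * (2 * Real.pi)⁻¹ ^ k = 1 := by
    rw [two_mul k, pow_add, inv_pow]
    field_simp
  have h7 := congrArg (fun r : ℝ => (r : ℂ)) h6
  push_cast at h7 ⊢
  rw [h7, one_mul]

theorem MeasureTheory.Integrable.mul_eiRe {α : Type*} [MeasurableSpace α] {μ : Measure α}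
    {h : α → ℂ} (hh : Integrable h μ) {g : α → ℂ} (hg : Measurable g) :
    Integrable (fun x => h x * eiRe (g x)) μ :=
  hh.mul_bdd (c := 1) (continuous_eiRe.measurable.comp hg).aestronglyMeasurable
    (Filter.Eventually.of_forall fun _ => (norm_eiRe _).le)

theorem continuous_dotProduct {k : ℕ} :
    Continuous fun p : (Fin k → ℂ) × (Fin k → ℂ) => p.1 ⬝ᵥ p.2 := by
  unfold dotProduct; fun_prop

@[fun_prop] theorem Continuous.dotProduct_complex {α : Type*} [TopologicalSpace α] {k : ℕ}
    {f g : α → Fin k → ℂ} (hf : Continuous f) (hg : Continuous g) :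
    Continuous fun x => f x ⬝ᵥ g x :=
  continuous_dotProduct.comp (hf.prodMk hg)

@[fun_prop] theorem Measurable.dotProduct_complex {α : Type*} [MeasurableSpace α] {k : ℕ}
    {f g : α → Fin k → ℂ} (hf : Measurable f) (hg : Measurable g) :
    Measurable fun x => f x ⬝ᵥ g x :=
  continuous_dotProduct.measurable.comp (hf.prodMk hg)

/-! ### Duality, inversion and Plancherel for integrable functions -/

section PiFourier

variable {k : ℕ} {g h : (Fin k → ℂ) → ℂ}

theorem norm_piFourier_le (h : (Fin k → ℂ) → ℂ) (y : Fin k → ℂ) :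
    ‖piFourier h y‖ ≤ ∫ ξ, ‖h ξ‖ ∂cnMeasure k := by
  refine (norm_integral_le_integral_norm _).trans_eq ?_
  simp

theorem continuous_piFourier (hh : Integrable h (cnMeasure k)) : Continuous (piFourier h) := by
  refine continuous_of_dominated (bound := fun ξ => ‖h ξ‖)
    (fun y => (hh.mul_eiRe (by fun_prop)).1)
    (fun y => Filter.Eventually.of_forall fun ξ => by simp) hh.norm
    (Filter.Eventually.of_forall fun ξ => by fun_prop)

theorem piFourier_congr_ae (hgh : g =ᵐ[cnMeasure k] h) : piFourier g = piFourier h := by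
  funext y
  refine integral_congr_ae ?_
  filter_upwards [hgh] with ξ hξ
  rw [hξ]

theorem conj_piFourier (h : (Fin k → ℂ) → ℂ) (y : Fin k → ℂ) :
    conj (piFourier h y) = piFourier (fun ξ => conj (h ξ)) (-y) := by
  simp only [piFourier, ← integral_conj, map_mul, conj_eiRe, dotProduct_neg]

theorem integral_piFourier_mul (hg : Integrable g (cnMeasure k))
    (hh : Integrable h (cnMeasure k)) :
    ∫ y, piFourier g y * h y ∂cnMeasure k = ∫ ξ, g ξ * piFourier h ξ ∂cnMeasure k := by
  have hi : Integrable (fun p : (Fin k → ℂ) × (Fin k → ℂ) => g p.2 * h p.1 * eiRe (p.2 ⬝ᵥ p.1))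
      ((cnMeasure k).prod (cnMeasure k)) := by
    refine Integrable.mul_eiRe ?_ (by fun_prop)
    simpa [mul_comm] using hh.mul_prod hg
  have h1 : ∀ y, piFourier g y * h y = ∫ ξ, g ξ * h y * eiRe (ξ ⬝ᵥ y) ∂cnMeasure k := by
    intro y
    rw [piFourier, ← integral_mul_const]
    congr 1; funext ξ; ring
  have h2 : ∀ ξ, g ξ * piFourier h ξ = ∫ y, g ξ * h y * eiRe (ξ ⬝ᵥ y) ∂cnMeasure k := by
    intro ξ
    rw [piFourier, ← integral_const_mul]
    congr 1; funext y; rw [dotProduct_comm]; ring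
  simp_rw [h1, h2]
  exact integral_integral_swap hi

theorem ae_eq_of_integral_schwartz_mul_eq (hg : LocallyIntegrable g (cnMeasure k))
    (hh : LocallyIntegrable h (cnMeasure k))
    (hgi : ∀ φ : 𝓢(Fin k → ℂ, ℂ), Integrable (fun x => g x * φ x) (cnMeasure k))
    (hhi : ∀ φ : 𝓢(Fin k → ℂ, ℂ), Integrable (fun x => h x * φ x) (cnMeasure k))
    (H : ∀ φ : 𝓢(Fin k → ℂ, ℂ), ∫ x, g x * φ x ∂cnMeasure k = ∫ x, h x * φ x ∂cnMeasure k) :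
    g =ᵐ[cnMeasure k] h := by
  have h1 := ae_eq_zero_of_integral_contDiff_smul_eq_zero (hg.sub hh) (fun b hb hc => by
    have hb' : ContDiff ℝ (⊤ : ℕ∞) (fun x => (b x : ℂ)) := Complex.ofRealCLM.contDiff.comp hb
    have hc' : HasCompactSupport (fun x => (b x : ℂ)) := hc.comp_left (g := Complex.ofReal) rfl
    have h2 := H (hc'.toSchwartzMap hb')
    have h3 := integral_sub (hgi (hc'.toSchwartzMap hb')) (hhi (hc'.toSchwartzMap hb'))
    rw [h2, sub_self] at h3
    rw [← h3]
    congr 1; funext x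
    simp only [Pi.sub_apply, Complex.real_smul]
    change _ = g x * (b x : ℂ) - h x * (b x : ℂ)
    ring)
  filter_upwards [h1] with x hx
  exact sub_eq_zero.1 hx

theorem MeasureTheory.Integrable.mul_schwartz (hg : Integrable g (cnMeasure k))
    (φ : 𝓢(Fin k → ℂ, ℂ)) : Integrable (fun x => g x * φ x) (cnMeasure k) :=
  hg.mul_bdd (c := SchwartzMap.seminorm ℝ 0 0 φ) φ.continuous.aestronglyMeasurable
    (Filter.Eventually.of_forall fun x => φ.norm_le_seminorm ℝ x)

theorem MeasureTheory.MemLp.mul_schwartz (hg : MemLp g 2 (cnMeasure k))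
    (φ : 𝓢(Fin k → ℂ, ℂ)) : Integrable (fun x => g x * φ x) (cnMeasure k) :=
  hg.integrable_mul (φ.memLp 2 (cnMeasure k))

theorem integral_schwartzFourier_mul (φ : 𝓢(Fin k → ℂ, ℂ)) (hh : Integrable h (cnMeasure k)) :
    ∫ y, h y * schwartzFourier k φ y ∂cnMeasure k = ∫ ξ, piFourier h ξ * φ ξ ∂cnMeasure k := by
  rw [integral_piFourier_mul hh φ.integrable]
  simp_rw [schwartzFourier_apply]

/-- The reflected function `x ↦ φ (-x)`. -/
noncomputable def schwartzNeg (k : ℕ) : 𝓢(Fin k → ℂ, ℂ) →L[ℂ] 𝓢(Fin k → ℂ, ℂ) :=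
  compCLMOfContinuousLinearEquiv ℂ (ContinuousLinearEquiv.neg ℝ)

theorem schwartzNeg_apply (φ : 𝓢(Fin k → ℂ, ℂ)) (x : Fin k → ℂ) : schwartzNeg k φ x = φ (-x) :=
  rfl

theorem schwartzFourier_schwartzNeg (φ : 𝓢(Fin k → ℂ, ℂ)) :
    schwartzFourier k (schwartzNeg k φ) = schwartzNeg k (schwartzFourier k φ) := by
  ext y
  rw [schwartzNeg_apply, schwartzFourier_apply, schwartzFourier_apply, piFourier, piFourier,
    ← integral_neg_eq_self]
  simp [schwartzNeg_apply]

/-- The Fourier transform on `𝓢(ℂ ^ k, ℂ)` as a linear equivalence. -/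
noncomputable def schwartzFourierEquiv (k : ℕ) : 𝓢(Fin k → ℂ, ℂ) ≃ₗ[ℂ] 𝓢(Fin k → ℂ, ℂ) :=
  LinearEquiv.ofLinearMap (schwartzFourier k).toLinearMap
    ((schwartzNeg k).comp (schwartzFourier k)).toLinearMap
    (by
      ext φ x
      change schwartzFourier k (schwartzNeg k (schwartzFourier k φ)) x = φ x
      rw [schwartzFourier_schwartzNeg, schwartzNeg_apply, schwartzFourier_schwartzFourier,
        neg_neg])
    (by
      ext φ x
      change schwartzNeg k (schwartzFourier k (schwartzFourier k φ)) x = φ x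
      rw [schwartzNeg_apply, schwartzFourier_schwartzFourier, neg_neg])

theorem schwartzFourier_surjective (k : ℕ) : Function.Surjective (schwartzFourier k) :=
  (schwartzFourierEquiv k).surjective

/-- Fourier inversion for an integrable function with integrable Fourier transform. -/
theorem piFourier_piFourier_ae_eq (hh : Integrable h (cnMeasure k))
    (hh' : Integrable (piFourier h) (cnMeasure k)) :
    ∀ᵐ ξ ∂cnMeasure k, piFourier (piFourier h) (-ξ) = h ξ := by
  have hc : Continuous fun ξ => piFourier (piFourier h) (-ξ) :=
    (continuous_piFourier hh').comp continuous_neg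
  have hci : ∀ φ : 𝓢(Fin k → ℂ, ℂ),
      Integrable (fun x => piFourier (piFourier h) (-x) * φ x) (cnMeasure k) := fun φ =>
    φ.integrable.bdd_mul (c := ∫ ξ, ‖piFourier h ξ‖ ∂cnMeasure k) hc.aestronglyMeasurable
      (Filter.Eventually.of_forall fun x => norm_piFourier_le _ _)
  refine ae_eq_of_integral_schwartz_mul_eq hc.locallyIntegrable hh.locallyIntegrable hci
    hh.mul_schwartz fun φ => ?_
  -- Every test function is a transform, so the duality formula can move both transforms onto
  -- Schwartz functions, where inversion is known.
  obtain ⟨ψ, rfl⟩ := schwartzFourier_surjective k φ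
  rw [integral_schwartzFourier_mul ψ hh, ← integral_neg_eq_self]
  have h1 : ∀ x, schwartzFourier k ψ (-x) = schwartzFourier k (schwartzNeg k ψ) x := fun x => by
    rw [schwartzFourier_schwartzNeg, schwartzNeg_apply]
  simp_rw [neg_neg, h1]
  rw [integral_piFourier_mul hh' (SchwartzMap.integrable _)]
  simp_rw [← schwartzFourier_apply, schwartzFourier_schwartzFourier, schwartzNeg_apply, neg_neg]

theorem ae_eq_of_piFourier_eq (hg : Integrable g (cnMeasure k)) (hh : Integrable h (cnMeasure k))
    (H : piFourier g = piFourier h) : g =ᵐ[cnMeasure k] h := by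
  refine ae_eq_of_integral_schwartz_mul_eq hg.locallyIntegrable hh.locallyIntegrable
    hg.mul_schwartz hh.mul_schwartz fun φ => ?_
  obtain ⟨ψ, rfl⟩ := schwartzFourier_surjective k φ
  rw [integral_schwartzFourier_mul ψ hg, integral_schwartzFourier_mul ψ hh, H]

/-- Duality pairs the transform of `φ` with its own conjugate, and the transform of that conjugate
is `conj φ` by inversion. -/
theorem norm_toLp_schwartzFourier (φ : 𝓢(Fin k → ℂ, ℂ)) :
    ‖toLpCLM ℂ ℂ 2 (cnMeasure k) (schwartzFourier k φ)‖ = ‖toLpCLM ℂ ℂ 2 (cnMeasure k) φ‖ := by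
  have h1 : ∀ ψ : 𝓢(Fin k → ℂ, ℂ), inner ℂ (toLpCLM ℂ ℂ 2 (cnMeasure k) ψ)
      (toLpCLM ℂ ℂ 2 (cnMeasure k) ψ) = ∫ x, ψ x * conj (ψ x) ∂cnMeasure k := by
    intro ψ
    rw [L2.inner_def]
    refine integral_congr_ae ?_
    filter_upwards [ψ.coeFn_toLp 2 (cnMeasure k)] with x hx
    rw [toLpCLM_apply, hx, Complex.mul_conj']
    simp
  have h2 : inner ℂ (toLpCLM ℂ ℂ 2 (cnMeasure k) (schwartzFourier k φ))
      (toLpCLM ℂ ℂ 2 (cnMeasure k) (schwartzFourier k φ)) =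
      inner ℂ (toLpCLM ℂ ℂ 2 (cnMeasure k) φ) (toLpCLM ℂ ℂ 2 (cnMeasure k) φ) := by
    rw [h1, h1]
    have hi : Integrable (fun x => conj (schwartzFourier k φ x)) (cnMeasure k) :=
      (schwartzConj (schwartzFourier k φ)).integrable
    simp_rw [schwartzFourier_apply φ] at hi ⊢
    rw [integral_piFourier_mul φ.integrable hi]
    refine integral_congr_ae (Filter.Eventually.of_forall fun x => ?_)
    simp only
    congr 1
    have h3 := schwartzFourier_schwartzFourier φ (-x)
    rw [neg_neg, schwartzFourier_apply] at h3
    rw [← h3, conj_piFourier, neg_neg]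
    simp_rw [schwartzFourier_apply φ]
  rw [inner_self_eq_norm_sq_to_K, inner_self_eq_norm_sq_to_K] at h2
  have h3 : ‖toLpCLM ℂ ℂ 2 (cnMeasure k) (schwartzFourier k φ)‖ ^ 2 =
      ‖toLpCLM ℂ ℂ 2 (cnMeasure k) φ‖ ^ 2 := by exact_mod_cast h2
  exact (sq_eq_sq₀ (norm_nonneg _) (norm_nonneg _)).1 h3

theorem denseRange_toLp (k : ℕ) : DenseRange (toLpCLM ℂ ℂ 2 (cnMeasure k)) :=
  denseRange_toLpCLM (F := ℂ) (p := 2) (μ := cnMeasure k) (by simp)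

/-- The Fourier transform on `L²(ℂ ^ k)`. -/
noncomputable def l2Fourier (k : ℕ) : Lp ℂ 2 (cnMeasure k) ≃ₗᵢ[ℂ] Lp ℂ 2 (cnMeasure k) :=
  (schwartzFourierEquiv k).extendOfIsometry (toLpCLM ℂ ℂ 2 (cnMeasure k)).toLinearMap
    (toLpCLM ℂ ℂ 2 (cnMeasure k)).toLinearMap (denseRange_toLp k) (denseRange_toLp k)
    norm_toLp_schwartzFourier

theorem l2Fourier_toLp (φ : 𝓢(Fin k → ℂ, ℂ)) :
    l2Fourier k (toLpCLM ℂ ℂ 2 (cnMeasure k) φ) =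
      toLpCLM ℂ ℂ 2 (cnMeasure k) (schwartzFourier k φ) :=
  LinearMap.extendOfNorm_eq (denseRange_toLp k)
    ⟨1, fun φ => (one_mul (‖toLpCLM ℂ ℂ 2 (cnMeasure k) φ‖)).symm ▸
      (norm_toLp_schwartzFourier φ).le⟩ φ

theorem continuous_integral_mul_schwartz (φ : 𝓢(Fin k → ℂ, ℂ)) :
    Continuous fun f : Lp ℂ 2 (cnMeasure k) => ∫ x, f x * φ x ∂cnMeasure k := by
  have h : ∀ f : Lp ℂ 2 (cnMeasure k), ∫ x, f x * φ x ∂cnMeasure k =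
      inner ℂ (toLpCLM ℂ ℂ 2 (cnMeasure k) (schwartzConj φ)) f := by
    intro f
    rw [L2.inner_def]
    refine integral_congr_ae ?_
    filter_upwards [(schwartzConj φ).coeFn_toLp 2 (cnMeasure k)] with x hx
    rw [toLpCLM_apply, hx]
    simp [schwartzConj]
  simp_rw [h]
  fun_prop

/-- This weak description, obtained by density, permits comparison of the abstract `L²` extension
with the integral `piFourier`. -/
theorem integral_l2Fourier_mul (f : Lp ℂ 2 (cnMeasure k)) (φ : 𝓢(Fin k → ℂ, ℂ)) :
    ∫ x, l2Fourier k f x * φ x ∂cnMeasure k =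
      ∫ x, f x * schwartzFourier k φ x ∂cnMeasure k := by
  refine (denseRange_toLp k).induction_on (p := fun f => ∫ x, l2Fourier k f x * φ x ∂cnMeasure k =
      ∫ x, f x * schwartzFourier k φ x ∂cnMeasure k) f ?_ fun ψ => ?_
  · exact isClosed_eq ((continuous_integral_mul_schwartz φ).comp (l2Fourier k).continuous)
      (continuous_integral_mul_schwartz _)
  · rw [l2Fourier_toLp]
    have h1 : ∀ χ θ : 𝓢(Fin k → ℂ, ℂ), ∫ x, toLpCLM ℂ ℂ 2 (cnMeasure k) χ x * θ x ∂cnMeasure k =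
        ∫ x, χ x * θ x ∂cnMeasure k := by
      intro χ θ
      refine integral_congr_ae ?_
      filter_upwards [χ.coeFn_toLp 2 (cnMeasure k)] with x hx
      rw [toLpCLM_apply, hx]
    rw [h1, h1, integral_schwartzFourier_mul φ ψ.integrable]
    simp_rw [schwartzFourier_apply ψ]

/-- Plancherel's theorem for integrable functions. -/
theorem eLpNorm_piFourier (hh : Integrable h (cnMeasure k)) :
    eLpNorm (piFourier h) 2 (cnMeasure k) = eLpNorm h 2 (cnMeasure k) := by
  have hci : ∀ φ : 𝓢(Fin k → ℂ, ℂ),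
      Integrable (fun x => piFourier h x * φ x) (cnMeasure k) := fun φ =>
    φ.integrable.bdd_mul (c := ∫ ξ, ‖h ξ‖ ∂cnMeasure k)
      (continuous_piFourier hh).aestronglyMeasurable
      (Filter.Eventually.of_forall fun x => norm_piFourier_le _ _)
  have key : ∀ f : Lp ℂ 2 (cnMeasure k), f =ᵐ[cnMeasure k] h →
      l2Fourier k f =ᵐ[cnMeasure k] piFourier h := by
    intro f hf
    refine ae_eq_of_integral_schwartz_mul_eq ((Lp.memLp _).locallyIntegrable (by norm_num))
      (continuous_piFourier hh).locallyIntegrable (Lp.memLp _).mul_schwartz hci fun φ => ?_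
    rw [integral_l2Fourier_mul, ← integral_schwartzFourier_mul φ hh]
    refine integral_congr_ae ?_
    filter_upwards [hf] with x hx
    rw [hx]
  have key' : ∀ f : Lp ℂ 2 (cnMeasure k), f =ᵐ[cnMeasure k] h →
      eLpNorm (piFourier h) 2 (cnMeasure k) = eLpNorm h 2 (cnMeasure k) := by
    intro f hf
    rw [← eLpNorm_congr_ae (key f hf), ← eLpNorm_congr_ae hf, ← Lp.enorm_def, ← Lp.enorm_def,
      LinearIsometryEquiv.enorm_map]
  -- The equality lives in `[0, ∞]`. If either norm is finite, `h` has an `L²` representative: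
  -- directly, or as the `L²` preimage of its transform. Otherwise both norms are infinite.
  by_cases h1 : MemLp h 2 (cnMeasure k)
  · exact key' _ h1.coeFn_toLp
  by_cases h2 : MemLp (piFourier h) 2 (cnMeasure k)
  · refine key' ((l2Fourier k).symm (h2.toLp _)) ?_
    refine ae_eq_of_integral_schwartz_mul_eq ((Lp.memLp _).locallyIntegrable (by norm_num))
      hh.locallyIntegrable (Lp.memLp _).mul_schwartz hh.mul_schwartz fun φ => ?_
    obtain ⟨ψ, rfl⟩ := schwartzFourier_surjective k φ
    rw [← integral_l2Fourier_mul, LinearIsometryEquiv.apply_symm_apply,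
      integral_schwartzFourier_mul ψ hh]
    refine integral_congr_ae ?_
    filter_upwards [h2.coeFn_toLp] with x hx
    rw [hx]
  · have h3 : eLpNorm h 2 (cnMeasure k) = ⊤ := by
      by_contra h; exact h1 ⟨hh.1, lt_top_iff_ne_top.2 h⟩
    have h4 : eLpNorm (piFourier h) 2 (cnMeasure k) = ⊤ := by
      by_contra h
      exact h2 ⟨(continuous_piFourier hh).aestronglyMeasurable, lt_top_iff_ne_top.2 h⟩
    rw [h3, h4]

end PiFourier

/-! ## Splitting off the last coordinate -/

instance cMeasure_isAddHaarMeasure : cMeasure.IsAddHaarMeasure :=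
  Measure.IsAddHaarMeasure.smul volume
    (by have := Real.pi_pos; simpa using by positivity) ENNReal.ofReal_ne_top

theorem ae_cMeasure_of_ae_volume {P : ℂ → Prop} (h : ∀ᵐ c, P c) : ∀ᵐ c ∂cMeasure, P c :=
  Measure.ae_smul_measure h _

theorem ae_cMeasure_ne_zero : ∀ᵐ c ∂cMeasure, c ≠ 0 := Measure.ae_ne _ _

/-- Passing from iterated to joint null sets requires measurability; Tonelli applied to `‖f - g‖ₑ`
supplies it. -/
theorem ae_eq_prod_of_ae_ae {α β : Type*} [MeasurableSpace α] [MeasurableSpace β]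
    {μ : Measure α} {ν : Measure β} [SFinite ν] {f g : α × β → ℂ}
    (hf : AEStronglyMeasurable f (μ.prod ν)) (hg : AEStronglyMeasurable g (μ.prod ν))
    (h : ∀ᵐ x ∂μ, ∀ᵐ y ∂ν, f (x, y) = g (x, y)) : f =ᵐ[μ.prod ν] g := by
  have h1 : ∫⁻ p, ‖(f - g) p‖ₑ ∂μ.prod ν = 0 := by
    rw [lintegral_prod _ (hf.sub hg).enorm]
    refine lintegral_eq_zero_of_ae_eq_zero ?_
    filter_upwards [h] with x hx
    refine lintegral_eq_zero_of_ae_eq_zero ?_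
    filter_upwards [hx] with y hy
    simp [hy]
  filter_upwards [(lintegral_eq_zero_iff' (hf.sub hg).enorm).1 h1] with p hp
  simpa [sub_eq_zero] using hp

/-- The measure on `ℂ × ℂ ^ m` that corresponds to `cnMeasure (m + 1)` when the last coordinate
is put first. -/
noncomputable abbrev splitMeasure (m : ℕ) : Measure (ℂ × (Fin m → ℂ)) :=
  cMeasure.prod (cnMeasure m)

/-- The coordinates `(c, ξ) ↦ (ξ, c)` on `ℂ ^ (m + 1)`. -/
noncomputable def glue (m : ℕ) : (ℂ × (Fin m → ℂ)) ≃ᵐ (Fin (m + 1) → ℂ) :=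
  (MeasurableEquiv.piFinSuccAbove (fun _ => ℂ) (Fin.last m)).symm

theorem glue_apply {m : ℕ} (p : ℂ × (Fin m → ℂ)) :
    glue m p = (Fin.snoc p.2 p.1 : Fin (m + 1) → ℂ) :=
  Fin.insertNth_last' _ _

theorem measurePreserving_glue (m : ℕ) :
    MeasurePreserving (glue m) (splitMeasure m) (cnMeasure (m + 1)) := by
  have h1 : MeasurePreserving (glue m) volume volume :=
    (volume_preserving_piFinSuccAbove (fun _ : Fin (m + 1) => ℂ) (Fin.last m)).symm
  have h2 : splitMeasure m = ENNReal.ofReal ((2 * Real.pi)⁻¹ ^ (m + 1)) •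
      (volume : Measure (ℂ × (Fin m → ℂ))) := by
    have hπ := Real.pi_pos
    rw [splitMeasure, cMeasure, cnMeasure, Measure.prod_smul_left, Measure.prod_smul_right,
      smul_smul, ← ENNReal.ofReal_mul (by positivity), ← pow_succ', ← Measure.volume_eq_prod]
  refine ⟨(glue m).measurable, ?_⟩
  rw [h2, Measure.map_smul, h1.map_eq, cnMeasure]

theorem snoc_dotProduct_snoc {m : ℕ} (ξ y : Fin m → ℂ) (c s : ℂ) :
    (Fin.snoc ξ c : Fin (m + 1) → ℂ) ⬝ᵥ (Fin.snoc y s : Fin (m + 1) → ℂ) = ξ ⬝ᵥ y + c * s := by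
  simp [dotProduct, Fin.sum_univ_castSucc]

theorem ae_fst_splitMeasure {m : ℕ} {P : ℂ → Prop} (h : ∀ᵐ c ∂cMeasure, P c) :
    ∀ᵐ p ∂splitMeasure m, P p.1 :=
  Measure.quasiMeasurePreserving_fst.ae h

theorem ae_splitMeasure_of_ae_forall {m : ℕ} {P : ℂ → (Fin m → ℂ) → Prop}
    (h : ∀ᵐ c ∂cMeasure, ∀ y, P c y) : ∀ᵐ p ∂splitMeasure m, P p.1 p.2 := by
  filter_upwards [ae_fst_splitMeasure h] with p hp using hp p.2

/-- The Fourier transform on `ℂ ^ (m + 1)` of a function in the coordinates of `glue`. -/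
noncomputable def splitFourier {m : ℕ} (h : ℂ × (Fin m → ℂ) → ℂ) : (Fin (m + 1) → ℂ) → ℂ :=
  piFourier (h ∘ (glue m).symm)

section SplitFourier

variable {m : ℕ} {g h : ℂ × (Fin m → ℂ) → ℂ}

theorem integrable_comp_glue_symm (hh : Integrable h (splitMeasure m)) :
    Integrable (h ∘ (glue m).symm) (cnMeasure (m + 1)) :=
  ((measurePreserving_glue m).symm _).integrable_comp_of_integrable hh

theorem splitFourier_apply (h : ℂ × (Fin m → ℂ) → ℂ) (x : Fin (m + 1) → ℂ) :
    splitFourier h x = ∫ p, h p * eiRe (glue m p ⬝ᵥ x) ∂splitMeasure m := by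
  rw [splitFourier, piFourier,
    ← (measurePreserving_glue m).integral_comp (glue m).measurableEmbedding]
  simp

theorem splitFourier_snoc (hh : Integrable h (splitMeasure m)) (y : Fin m → ℂ) (s : ℂ) :
    splitFourier h (Fin.snoc y s : Fin (m + 1) → ℂ) =
      ∫ c, piFourier (fun ξ => h (c, ξ)) y * eiRe (c * s) ∂cMeasure := by
  rw [splitFourier_apply, integral_prod]
  · congr 1; funext c
    rw [piFourier, ← integral_mul_const]
    congr 1; funext ξ
    rw [glue_apply, snoc_dotProduct_snoc, eiRe_add, mul_assoc]
  · exact hh.mul_eiRe (by fun_prop)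

theorem splitFourier_congr_ae (hgh : g =ᵐ[splitMeasure m] h) :
    splitFourier g = splitFourier h :=
  piFourier_congr_ae (((measurePreserving_glue m).symm _).quasiMeasurePreserving.ae_eq_comp hgh)

theorem ae_eq_of_splitFourier_eq (hg : Integrable g (splitMeasure m))
    (hh : Integrable h (splitMeasure m)) (H : splitFourier g = splitFourier h) :
    g =ᵐ[splitMeasure m] h := by
  have h1 := (measurePreserving_glue m).quasiMeasurePreserving.ae_eq_comp
    (ae_eq_of_piFourier_eq (integrable_comp_glue_symm hg) (integrable_comp_glue_symm hh) H)
  simpa [Function.comp_def] using h1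

theorem eLpNorm_splitFourier (hh : Integrable h (splitMeasure m)) :
    eLpNorm (splitFourier h) 2 (cnMeasure (m + 1)) = eLpNorm h 2 (splitMeasure m) := by
  rw [splitFourier, eLpNorm_piFourier (integrable_comp_glue_symm hh),
    eLpNorm_comp_measurePreserving hh.1 ((measurePreserving_glue m).symm _)]

theorem continuous_splitFourier (hh : Integrable h (splitMeasure m)) :
    Continuous (splitFourier h) :=
  continuous_piFourier (integrable_comp_glue_symm hh)

theorem splitFourier_add (hg : Integrable g (splitMeasure m)) (hh : Integrable h (splitMeasure m)) :
    splitFourier (g + h) = splitFourier g + splitFourier h := by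
  funext x
  simp only [splitFourier_apply, Pi.add_apply, add_mul]
  exact integral_add (hg.mul_eiRe (by fun_prop)) (hh.mul_eiRe (by fun_prop))

theorem splitFourier_smul (a : ℂ) (h : ℂ × (Fin m → ℂ) → ℂ) :
    splitFourier (a • h) = a • splitFourier h := by
  funext x
  simp only [splitFourier_apply, Pi.smul_apply, smul_eq_mul, mul_assoc]
  exact integral_const_mul _ _

/-! ## The Fourier transform in the first variables -/

/-- The Fourier transform of `h (c, ·)`. -/
noncomputable def fiberFourier (h : ℂ × (Fin m → ℂ) → ℂ) (p : ℂ × (Fin m → ℂ)) : ℂ :=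
  piFourier (fun ξ => h (p.1, ξ)) p.2

/-- A Fourier integral ignores null sets, so equality holds at every `y` once `c` is generic. This
allows `y` to be replaced later by a multiple that depends on `c`. -/
theorem fiberFourier_congr_ae (hgh : g =ᵐ[splitMeasure m] h) :
    ∀ᵐ c ∂cMeasure, ∀ y, fiberFourier g (c, y) = fiberFourier h (c, y) := by
  filter_upwards [Measure.ae_ae_of_ae_prod hgh] with c hc y
  exact congrFun (piFourier_congr_ae hc) y

theorem stronglyMeasurable_fiberFourier (hh : StronglyMeasurable h) :
    StronglyMeasurable (fiberFourier h) := by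
  unfold fiberFourier piFourier
  refine StronglyMeasurable.integral_prod_right' (f := fun q : (ℂ × (Fin m → ℂ)) × (Fin m → ℂ) =>
    h (q.1.1, q.2) * eiRe (q.2 ⬝ᵥ q.1.2)) (StronglyMeasurable.mul ?_ ?_)
  · exact hh.comp_measurable (by fun_prop)
  · exact (Continuous.stronglyMeasurable (by fun_prop))

theorem aestronglyMeasurable_fiberFourier (hh : AEStronglyMeasurable h (splitMeasure m)) :
    AEStronglyMeasurable (fiberFourier h) (splitMeasure m) :=
  ⟨_, stronglyMeasurable_fiberFourier hh.stronglyMeasurable_mk,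
    ae_splitMeasure_of_ae_forall (P := fun c y => fiberFourier h (c, y) = _)
      (fiberFourier_congr_ae hh.ae_eq_mk)⟩

theorem ae_fiberFourier_add (hg : Integrable g (splitMeasure m))
    (hh : Integrable h (splitMeasure m)) :
    ∀ᵐ c ∂cMeasure, ∀ y, fiberFourier (g + h) (c, y) =
      fiberFourier g (c, y) + fiberFourier h (c, y) := by
  filter_upwards [hg.prod_right_ae, hh.prod_right_ae] with c h1 h2 y
  simp only [fiberFourier, piFourier, Pi.add_apply, add_mul]
  exact integral_add (h1.mul_eiRe (by fun_prop)) (h2.mul_eiRe (by fun_prop))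

theorem fiberFourier_smul (a : ℂ) (h : ℂ × (Fin m → ℂ) → ℂ) (p : ℂ × (Fin m → ℂ)) :
    fiberFourier (a • h) p = a * fiberFourier h p := by
  simp only [fiberFourier, piFourier, Pi.smul_apply, smul_eq_mul, mul_assoc]
  exact integral_const_mul _ _

end SplitFourier

/-! ## Complex dilations of `ℂ ^ m` -/

/-- Multiplication by `a` is a coordinatewise rotation followed by the real dilation `‖a‖`. The
rotation preserves volume and the dilation acts in real dimension `2m`. -/
theorem map_complex_smul_cnMeasure (m : ℕ) {a : ℂ} (ha : a ≠ 0) :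
    Measure.map (fun η : Fin m → ℂ => a • η) (cnMeasure m) =
      (‖a‖ₑ ^ (2 * m))⁻¹ • cnMeasure m := by
  have hr : ‖a‖ ≠ 0 := norm_ne_zero_iff.2 ha
  let b : Circle := ⟨a / ‖a‖, mem_sphere_zero_iff_norm.2 <| by
    rw [norm_div, Complex.norm_real, norm_norm, div_self hr]⟩
  have hb : ∀ z : ℂ, rotation b z = a / ‖a‖ * z := fun z => rotation_apply b z
  have h1 : MeasurePreserving (fun (η : Fin m → ℂ) i => rotation b (η i)) volume volume :=
    volume_preserving_pi fun _ => (rotation b).measurePreserving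
  have h2 : MeasurePreserving (fun (η : Fin m → ℂ) i => rotation b (η i)) (cnMeasure m)
      (cnMeasure m) := by
    refine ⟨h1.measurable, ?_⟩
    rw [cnMeasure, Measure.map_smul, h1.map_eq]
  have h3 : (fun η : Fin m → ℂ => a • η) =
      (fun η : Fin m → ℂ => ‖a‖ • η) ∘ fun η i => rotation b (η i) := by
    funext η i
    simp only [Function.comp_apply, Pi.smul_apply, hb, smul_eq_mul, Complex.real_smul]
    have : (‖a‖ : ℂ) ≠ 0 := by exact_mod_cast hr
    field_simp
  have hd : Module.finrank ℝ (Fin m → ℂ) = 2 * m := by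
    rw [Module.finrank_pi_fintype]
    simp [Complex.finrank_real_complex, mul_comm]
  rw [h3, ← Measure.map_map (by fun_prop) h2.measurable, h2.map_eq,
    Measure.map_addHaar_smul _ hr, hd]
  congr 1
  have hp : 0 < ‖a‖ := norm_pos_iff.2 ha
  rw [abs_of_nonneg (by positivity), ENNReal.ofReal_inv_of_pos (by positivity),
    ENNReal.ofReal_pow (norm_nonneg _), ofReal_norm]

theorem lintegral_complex_smul (m : ℕ) {a : ℂ} (ha : a ≠ 0) (F : (Fin m → ℂ) → ENNReal) :
    ∫⁻ η, F (a • η) ∂cnMeasure m = (‖a‖ₑ ^ (2 * m))⁻¹ * ∫⁻ η, F η ∂cnMeasure m := by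
  rw [← smul_eq_mul, ← lintegral_smul_measure, ← map_complex_smul_cnMeasure m ha]
  exact ((Homeomorph.smulOfNeZero a ha).measurableEmbedding.lintegral_map F).symm

theorem integral_complex_smul (m : ℕ) {a : ℂ} (ha : a ≠ 0) (F : (Fin m → ℂ) → ℂ) :
    ∫ η, F (a • η) ∂cnMeasure m = (‖a‖ ^ (2 * m) : ℂ)⁻¹ * ∫ η, F η ∂cnMeasure m := by
  have h := integral_smul_measure (μ := cnMeasure m) F (‖a‖ₑ ^ (2 * m))⁻¹
  rw [← map_complex_smul_cnMeasure m ha] at h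
  have h1 := (Homeomorph.smulOfNeZero a ha).measurableEmbedding.integral_map
    (μ := cnMeasure m) F
  refine h1.symm.trans (h.trans ?_)
  simp

theorem ae_complex_smul (m : ℕ) {a : ℂ} (ha : a ≠ 0) {P : (Fin m → ℂ) → Prop}
    (h : ∀ᵐ η ∂cnMeasure m, P η) : ∀ᵐ η ∂cnMeasure m, P (a • η) := by
  refine ae_of_ae_map (f := fun η : Fin m → ℂ => a • η) (by fun_prop) ?_
  rw [map_complex_smul_cnMeasure m ha]
  exact Measure.ae_smul_measure h _

/-! ## The Radon transform on the Fourier side -/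

/-- The Fourier transforms `w` of the generalized functions that define Radon transforms. -/
structure IsRadonMultiplier (m : ℕ) (w : ℂ → ℂ) : Prop where
  aestronglyMeasurable : AEStronglyMeasurable w cMeasure
  norm_ae : ∀ᵐ c ∂cMeasure, ‖w c‖ = ‖c‖ ^ m

theorem IsRadonMultiplier.conj {m : ℕ} {w : ℂ → ℂ} (hw : IsRadonMultiplier m w) :
    IsRadonMultiplier m (fun c => conj (w c)) where
  aestronglyMeasurable := Complex.continuous_conj.comp_aestronglyMeasurable hw.1
  norm_ae := by filter_upwards [hw.2] with c hc; simpa using hc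

/-- The Radon transform in terms of Fourier transforms. -/
noncomputable def radonMul {m : ℕ} (w : ℂ → ℂ) (ε : ℂ) (h : ℂ × (Fin m → ℂ) → ℂ)
    (p : ℂ × (Fin m → ℂ)) : ℂ :=
  w p.1 * ((‖p.1‖ : ℂ) ^ (2 * m))⁻¹ * fiberFourier h (p.1, (ε * p.1⁻¹) • p.2)

/-- The Fourier transforms of functions in the test space of the Radon transform. -/
structure RadonAdmissible {m : ℕ} (h : ℂ × (Fin m → ℂ) → ℂ) : Prop where
  integrable : Integrable h (splitMeasure m)
  memLp_two : MemLp h 2 (splitMeasure m)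
  lintegral_lt_top : ∫⁻ p, ‖p.1‖ₑ ^ m * ‖fiberFourier h p‖ₑ ∂splitMeasure m < ⊤

section RadonMul

variable {m : ℕ} {w : ℂ → ℂ} {ε : ℂ} {g h : ℂ × (Fin m → ℂ) → ℂ}

theorem radonMul_congr_ae (hgh : g =ᵐ[splitMeasure m] h) :
    radonMul w ε g =ᵐ[splitMeasure m] radonMul w ε h := by
  filter_upwards [ae_fst_splitMeasure (fiberFourier_congr_ae hgh)] with p hp
  rw [radonMul, radonMul, hp]

theorem radonMul_add (hg : Integrable g (splitMeasure m)) (hh : Integrable h (splitMeasure m)) :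
    radonMul w ε (g + h) =ᵐ[splitMeasure m] radonMul w ε g + radonMul w ε h := by
  filter_upwards [ae_fst_splitMeasure (ae_fiberFourier_add hg hh)] with p hp
  simp only [radonMul, hp, Pi.add_apply, mul_add]

theorem radonMul_smul (a : ℂ) : radonMul w ε (a • h) = a • radonMul w ε h := by
  funext p
  simp only [radonMul, fiberFourier_smul, Pi.smul_apply, smul_eq_mul]
  ring

theorem aestronglyMeasurable_radonMul (hw : IsRadonMultiplier m w)
    (hh : AEStronglyMeasurable h (splitMeasure m)) :
    AEStronglyMeasurable (radonMul w ε h) (splitMeasure m) := by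
  refine AEStronglyMeasurable.congr ?_ (radonMul_congr_ae (w := w) (ε := ε) hh.ae_eq_mk).symm
  refine AEStronglyMeasurable.mul (hw.1.comp_fst.mul ?_) ?_
  · exact (Measurable.stronglyMeasurable (by fun_prop)).aestronglyMeasurable
  · exact ((stronglyMeasurable_fiberFourier hh.stronglyMeasurable_mk).comp_measurable
      (g := fun p : ℂ × (Fin m → ℂ) => (p.1, (ε * p.1⁻¹) • p.2))
      (by fun_prop)).aestronglyMeasurable

/-! ### Norms and transforms on a single fibre -/

theorem enorm_of_mul_self_eq_one (hε : ε * ε = 1) : ‖ε‖ₑ = 1 := by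
  have h1 : ‖ε‖ * ‖ε‖ = 1 := by rw [← norm_mul, hε, norm_one]
  have h2 : ‖ε‖ = 1 := by nlinarith [norm_nonneg ε]
  rw [← ofReal_norm, h2, ENNReal.ofReal_one]

/-- The multiplier has modulus `|c|^m |c|^(-2m) = |c|^(-m)`, and undoing the dilation by `ε c⁻¹`
costs `|c|^(2m)`. The net factor is `|c|^m` for the first power and 1 for the square; the latter is
where the exponent `m` in `|w| = |c|^m` is decisive. -/
theorem lintegral_fiber_radonMul (hε : ε * ε = 1) {c : ℂ} (hc : c ≠ 0) (hwc : ‖w c‖ = ‖c‖ ^ m)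
    (h : ℂ × (Fin m → ℂ) → ℂ) :
    ∫⁻ η, ‖radonMul w ε h (c, η)‖ₑ ∂cnMeasure m =
      ‖c‖ₑ ^ m * ∫⁻ y, ‖fiberFourier h (c, y)‖ₑ ∂cnMeasure m ∧
    ∫⁻ η, ‖radonMul w ε h (c, η)‖ₑ ^ (2 : ℝ) ∂cnMeasure m =
      ∫⁻ y, ‖fiberFourier h (c, y)‖ₑ ^ (2 : ℝ) ∂cnMeasure m := by
  have hε0 : ε ≠ 0 := by rintro rfl; simp at hε
  have ha : ε * c⁻¹ ≠ 0 := mul_ne_zero hε0 (inv_ne_zero hc)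
  have hc0 : ‖c‖ₑ ≠ 0 := by simpa using hc
  have hct : ‖c‖ₑ ≠ ⊤ := enorm_ne_top
  have hwe : ‖w c‖ₑ = ‖c‖ₑ ^ m := by
    rw [← ofReal_norm, hwc, ENNReal.ofReal_pow (norm_nonneg _), ofReal_norm]
  have h1 : ∀ η, ‖radonMul w ε h (c, η)‖ₑ =
      (‖c‖ₑ ^ m)⁻¹ * ‖fiberFourier h (c, (ε * c⁻¹) • η)‖ₑ := by
    intro η
    have h2 : ‖((‖c‖ : ℂ) ^ (2 * m))⁻¹‖ₑ = (‖c‖ₑ ^ (2 * m))⁻¹ := by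
      have : ((‖c‖ : ℂ) ^ (2 * m)) ≠ 0 := pow_ne_zero _ (by simpa using hc)
      rw [enorm_inv this, enorm_pow]
      congr 2
      rw [← ofReal_norm, ← ofReal_norm, Complex.norm_real, norm_norm]
    simp only [radonMul]
    rw [enorm_mul, enorm_mul, hwe, h2]
    congr 1
    rw [two_mul, pow_add, ENNReal.mul_inv (by simp [hc0]) (by simp [hct]), ← mul_assoc,
      ENNReal.mul_inv_cancel (by simp [hc0]) (by simp [hct]), one_mul]
  have hs : (‖ε * c⁻¹‖ₑ ^ (2 * m))⁻¹ = ‖c‖ₑ ^ m * ‖c‖ₑ ^ m := by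
    rw [enorm_mul, enorm_of_mul_self_eq_one hε, one_mul, enorm_inv hc, ENNReal.inv_pow.symm,
      inv_inv, two_mul, pow_add]
  constructor
  · simp_rw [h1]
    rw [lintegral_const_mul' _ _ (by simp [hc0]),
      lintegral_complex_smul m ha (fun y => ‖fiberFourier h (c, y)‖ₑ), hs, ← mul_assoc,
      ← mul_assoc, ENNReal.inv_mul_cancel (by simp [hc0]) (by simp [hct]), one_mul]
  · simp_rw [h1, ENNReal.mul_rpow_of_nonneg _ _ zero_le_two]
    rw [lintegral_const_mul' _ _ (by simp [hc0]),
      lintegral_complex_smul m ha (fun y => ‖fiberFourier h (c, y)‖ₑ ^ (2 : ℝ)), hs, ← mul_assoc,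
      ENNReal.rpow_two, sq, mul_mul_mul_comm,
      ENNReal.inv_mul_cancel (pow_ne_zero m hc0) (ENNReal.pow_ne_top hct), one_mul, one_mul]

/-- Substituting `η = ε c y` produces the Jacobian that cancels `|c|^(-2m)` and moves the dilation
onto `b`, since `ε c` and `ε c⁻¹` are mutually inverse. A fibre inversion then reads off `w c * h
(c, -(ε c) b)`. -/
theorem fiberFourier_radonMul (hε : ε * ε = 1) {c : ℂ} (hc : c ≠ 0)
    (h : ℂ × (Fin m → ℂ) → ℂ) (b : Fin m → ℂ) :
    fiberFourier (radonMul w ε h) (c, b) =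
      w c * piFourier (fun y => fiberFourier h (c, y)) ((ε * c) • b) := by
  have hε0 : ε ≠ 0 := by rintro rfl; simp at hε
  have ha : ε * c⁻¹ ≠ 0 := mul_ne_zero hε0 (inv_ne_zero hc)
  have hn : ‖ε * c⁻¹‖ = ‖c‖⁻¹ := by
    have h1 : ‖ε‖ * ‖ε‖ = 1 := by rw [← norm_mul, hε, norm_one]
    have h2 : ‖ε‖ = 1 := by nlinarith [norm_nonneg ε]
    rw [norm_mul, h2, norm_inv, one_mul]
  have h1 : ∀ η, radonMul w ε h (c, η) * eiRe (η ⬝ᵥ b) = w c * ((‖c‖ : ℂ) ^ (2 * m))⁻¹ *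
      (fun y => fiberFourier h (c, y) * eiRe (y ⬝ᵥ ((ε * c) • b))) ((ε * c⁻¹) • η) := by
    intro η
    have h2 : (ε * c) * (ε * c⁻¹) = 1 := by
      rw [mul_mul_mul_comm, hε, mul_inv_cancel₀ hc, one_mul]
    simp only [radonMul, dotProduct_smul, smul_dotProduct, smul_smul, h2, one_smul, mul_assoc]
  simp only [fiberFourier, piFourier] at h1 ⊢
  simp_rw [h1]
  have h3 := integral_complex_smul m ha
    (fun y => fiberFourier h (c, y) * eiRe (y ⬝ᵥ ((ε * c) • b)))
  simp only [fiberFourier, piFourier] at h3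
  rw [integral_const_mul, h3, hn]
  have h4 : (‖c‖ : ℂ) ≠ 0 := by simpa using hc
  rw [Complex.ofReal_inv, inv_pow, inv_inv, ← mul_assoc, mul_assoc (w c),
    inv_mul_cancel₀ (pow_ne_zero _ h4), mul_one]

/-! ### Invariance of the admissible symbols and the inverse operator -/

/-- On the fibre over `c ≠ 0` the weight `|c|^m` is a nonzero constant and can be divided out, so
Fourier inversion is available on almost every fibre. -/
theorem RadonAdmissible.fiber_integrable (hh : RadonAdmissible h) :
    ∀ᵐ c ∂cMeasure, Integrable (fun ξ => h (c, ξ)) (cnMeasure m) ∧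
      Integrable (fun y => fiberFourier h (c, y)) (cnMeasure m) := by
  have hm := aestronglyMeasurable_fiberFourier hh.integrable.1
  have h1 : AEMeasurable (fun p : ℂ × (Fin m → ℂ) => ‖p.1‖ₑ ^ m * ‖fiberFourier h p‖ₑ)
      (splitMeasure m) := (by fun_prop : AEMeasurable _ _).mul hm.enorm
  have h2 := hh.lintegral_lt_top
  rw [lintegral_prod _ h1] at h2
  filter_upwards [hh.integrable.prod_right_ae, hm.prodMk_left, ae_cMeasure_ne_zero,
    ae_lt_top' h1.lintegral_prod_right' h2.ne] with c hc1 hc2 hc3 hc4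
  refine ⟨hc1, hc2, ?_⟩
  have hc0 : ‖c‖ₑ ^ m ≠ 0 := by simp [hc3]
  rw [lintegral_const_mul' _ _ (by simp)] at hc4
  exact lt_top_iff_ne_top.2 fun h => by rw [h, ENNReal.mul_top hc0] at hc4; exact lt_irrefl _ hc4

theorem RadonAdmissible.fiber_inversion (hh : RadonAdmissible h) :
    ∀ᵐ c ∂cMeasure, ∀ᵐ ξ ∂cnMeasure m,
      piFourier (fun y => fiberFourier h (c, y)) (-ξ) = h (c, ξ) :=
  hh.fiber_integrable.mono fun c hc =>
    piFourier_piFourier_ae_eq (h := fun ξ => h (c, ξ)) hc.1 hc.2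

/-- Thus the weighted condition in `RadonAdmissible` says precisely that the transformed symbol is
integrable. -/
theorem lintegral_enorm_radonMul (hw : IsRadonMultiplier m w) (hε : ε * ε = 1)
    (hh : AEStronglyMeasurable h (splitMeasure m)) :
    ∫⁻ p, ‖radonMul w ε h p‖ₑ ∂splitMeasure m =
      ∫⁻ p, ‖p.1‖ₑ ^ m * ‖fiberFourier h p‖ₑ ∂splitMeasure m := by
  have hm := aestronglyMeasurable_fiberFourier hh
  have h1 : AEMeasurable (fun p : ℂ × (Fin m → ℂ) => ‖p.1‖ₑ ^ m * ‖fiberFourier h p‖ₑ)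
      (splitMeasure m) := (by fun_prop : AEMeasurable _ _).mul hm.enorm
  rw [lintegral_prod _ h1, lintegral_prod _ (aestronglyMeasurable_radonMul hw hh).enorm]
  refine lintegral_congr_ae ?_
  filter_upwards [ae_cMeasure_ne_zero, hw.2] with c hc hwc
  rw [lintegral_const_mul' _ _ (by simp)]
  exact (lintegral_fiber_radonMul hε hc hwc h).1

theorem eLpNorm_radonMul (hw : IsRadonMultiplier m w) (hε : ε * ε = 1)
    (hh : Integrable h (splitMeasure m)) :
    eLpNorm (radonMul w ε h) 2 (splitMeasure m) = eLpNorm h 2 (splitMeasure m) := by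
  have key : ∫⁻ p, ‖radonMul w ε h p‖ₑ ^ (2 : ℝ) ∂splitMeasure m =
      ∫⁻ p, ‖h p‖ₑ ^ (2 : ℝ) ∂splitMeasure m := by
    rw [lintegral_prod _ (hh.1.enorm.pow_const _),
      lintegral_prod _ ((aestronglyMeasurable_radonMul hw hh.1).enorm.pow_const _)]
    refine lintegral_congr_ae ?_
    filter_upwards [ae_cMeasure_ne_zero, hw.2, hh.prod_right_ae] with c hc hwc hhc
    rw [(lintegral_fiber_radonMul hε hc hwc h).2]
    have h1 := eLpNorm_piFourier hhc
    rw [eLpNorm_eq_lintegral_rpow_enorm_toReal (by simp) (by simp),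
      eLpNorm_eq_lintegral_rpow_enorm_toReal (by simp) (by simp)] at h1
    simp only [ENNReal.toReal_ofNat] at h1
    exact ENNReal.rpow_left_injective (x := 1 / 2) (by norm_num) h1
  rw [eLpNorm_eq_lintegral_rpow_enorm_toReal (by simp) (by simp),
    eLpNorm_eq_lintegral_rpow_enorm_toReal (by simp) (by simp)]
  simp only [ENNReal.toReal_ofNat, key]

theorem RadonAdmissible.ae_fiberFourier_radonMul (hh : RadonAdmissible h) (hε : ε * ε = 1) :
    ∀ᵐ c ∂cMeasure, ∀ᵐ b ∂cnMeasure m,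
      fiberFourier (radonMul w ε h) (c, b) = w c * h (c, (-(ε * c)) • b) := by
  have hε0 : ε ≠ 0 := by rintro rfl; simp at hε
  filter_upwards [hh.fiber_inversion, ae_cMeasure_ne_zero] with c hc hc0
  filter_upwards [ae_complex_smul m (neg_ne_zero.2 (mul_ne_zero hε0 hc0)) hc] with b hb
  rw [fiberFourier_radonMul hε hc0, ← hb, neg_smul, neg_neg]

/-- The two `L¹` conditions change places: the weighted one for `h` is integrability of the image,
and the weighted one for the image is integrability of `h`, by fibre inversion and the dilation `b ↦
-(ε c) b`. -/
theorem RadonAdmissible.radonMul (hh : RadonAdmissible h) (hw : IsRadonMultiplier m w)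
    (hε : ε * ε = 1) : RadonAdmissible (radonMul w ε h) where
  integrable := ⟨aestronglyMeasurable_radonMul hw hh.integrable.1, by
    rw [hasFiniteIntegral_iff_enorm, lintegral_enorm_radonMul hw hε hh.integrable.1]
    exact hh.lintegral_lt_top⟩
  memLp_two := ⟨aestronglyMeasurable_radonMul hw hh.integrable.1, by
    rw [eLpNorm_radonMul hw hε hh.integrable]
    exact hh.memLp_two.2⟩
  lintegral_lt_top := by
    have hε0 : ε ≠ 0 := by rintro rfl; simp at hε
    have hA := aestronglyMeasurable_radonMul (ε := ε) hw hh.integrable.1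
    have hm := aestronglyMeasurable_fiberFourier hA
    have h1 : AEMeasurable (fun p : ℂ × (Fin m → ℂ) =>
        ‖p.1‖ₑ ^ m * ‖fiberFourier (_root_.radonMul w ε h) p‖ₑ) (splitMeasure m) :=
      (by fun_prop : AEMeasurable _ _).mul hm.enorm
    have h2 := hh.integrable.2
    rw [hasFiniteIntegral_iff_enorm, lintegral_prod _ hh.integrable.1.enorm] at h2
    rw [lintegral_prod _ h1]
    refine lt_of_le_of_lt (le_of_eq (lintegral_congr_ae ?_)) h2
    filter_upwards [hh.ae_fiberFourier_radonMul hε (w := w), ae_cMeasure_ne_zero, hw.2]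
      with c hc hc0 hwc
    have hce : ‖c‖ₑ ≠ 0 := by simpa using hc0
    have hwe : ‖w c‖ₑ = ‖c‖ₑ ^ m := by
      rw [← ofReal_norm, hwc, ENNReal.ofReal_pow (norm_nonneg _), ofReal_norm]
    have h3 : ∫⁻ b, ‖c‖ₑ ^ m * ‖fiberFourier (_root_.radonMul w ε h) (c, b)‖ₑ ∂cnMeasure m =
        ∫⁻ b, ‖c‖ₑ ^ (2 * m) * ‖h (c, (-(ε * c)) • b)‖ₑ ∂cnMeasure m := by
      refine lintegral_congr_ae ?_
      filter_upwards [hc] with b hb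
      rw [hb, enorm_mul, hwe, ← mul_assoc, ← pow_add, two_mul]
    rw [h3, lintegral_const_mul' _ _ (by simp),
      lintegral_complex_smul m (neg_ne_zero.2 (mul_ne_zero hε0 hc0)) (fun b => ‖h (c, b)‖ₑ),
      enorm_neg, enorm_mul, enorm_of_mul_self_eq_one hε, one_mul, ← mul_assoc,
      ENNReal.mul_inv_cancel (by simp [hce]) (by simp), one_mul]

/-- The sign change in `ε` compensates the reflection produced by two fibre transforms: the
dilations combine to `(ε c)(-ε c⁻¹) = -1`. -/
theorem RadonAdmissible.radonMul_conj_radonMul (hh : RadonAdmissible h)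
    (hw : IsRadonMultiplier m w) (hε : ε * ε = 1) :
    _root_.radonMul (fun c => conj (w c)) (-ε) (_root_.radonMul w ε h) =ᵐ[splitMeasure m] h := by
  have hA := (hh.radonMul hw hε).radonMul hw.conj (ε := -ε) (by simpa using hε)
  have hε0 : ε ≠ 0 := by rintro rfl; simp at hε
  refine ae_eq_prod_of_ae_ae hA.integrable.1 hh.integrable.1 ?_
  filter_upwards [hh.fiber_inversion, ae_cMeasure_ne_zero, hw.2] with c hc hc0 hwc
  filter_upwards [hc] with ξ hξ
  have h1 : (ε * c) * (-ε * c⁻¹) = -1 := by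
    rw [mul_mul_mul_comm, mul_neg, hε, mul_inv_cancel₀ hc0, mul_one]
  have h2 : conj (w c) * w c = (‖c‖ : ℂ) ^ (2 * m) := by
    rw [Complex.conj_mul', hwc, two_mul, pow_add, sq]
    push_cast; rfl
  have h3 : ((‖c‖ : ℂ) ^ (2 * m)) ≠ 0 := pow_ne_zero _ (by simpa using hc0)
  have h4 : ∀ k : ℂ, conj (w c) * ((‖c‖ : ℂ) ^ (2 * m))⁻¹ * (w c * k) = k := fun k => by
    rw [mul_right_comm, ← mul_assoc, h2, mul_right_comm, mul_inv_cancel₀ h3, one_mul]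
  rw [_root_.radonMul, fiberFourier_radonMul hε hc0, smul_smul, h1, neg_one_smul, hξ, h4]

end RadonMul

/-! ## The test space is closed under multiplication -/

/-- The convolution on `ℂ × ℂ ^ m`. -/
noncomputable def splitConvolution {m : ℕ} (g h : ℂ × (Fin m → ℂ) → ℂ) :
    ℂ × (Fin m → ℂ) → ℂ :=
  convolution g h (ContinuousLinearMap.mul ℂ ℂ) (splitMeasure m)

section SplitConvolution

variable {m : ℕ} {g h : ℂ × (Fin m → ℂ) → ℂ}

theorem RadonAdmissible.congr_ae (hh : RadonAdmissible h) (hgh : h =ᵐ[splitMeasure m] g) :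
    RadonAdmissible g where
  integrable := hh.integrable.congr hgh
  memLp_two := (memLp_congr_ae hgh).1 hh.memLp_two
  lintegral_lt_top := by
    refine lt_of_le_of_lt (le_of_eq (lintegral_congr_ae ?_)) hh.lintegral_lt_top
    filter_upwards [ae_fst_splitMeasure (fiberFourier_congr_ae hgh)] with p hp
    rw [← hp]

theorem splitConvolution_apply (g h : ℂ × (Fin m → ℂ) → ℂ) (p : ℂ × (Fin m → ℂ)) :
    splitConvolution g h p = ∫ q, g q * h (p - q) ∂splitMeasure m := rfl

theorem integrable_splitConvolution (hg : Integrable g (splitMeasure m))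
    (hh : Integrable h (splitMeasure m)) : Integrable (splitConvolution g h) (splitMeasure m) :=
  hg.integrable_convolution _ hh

theorem glue_add (p q : ℂ × (Fin m → ℂ)) : glue m (p + q) = glue m p + glue m q := by
  simp only [glue_apply]
  funext j
  refine Fin.lastCases ?_ (fun i => ?_) j <;> simp

theorem splitFourier_splitConvolution (hg : Integrable g (splitMeasure m))
    (hh : Integrable h (splitMeasure m)) :
    splitFourier (splitConvolution g h) = splitFourier g * splitFourier h := by
  funext x
  have hgl : Measurable fun p => glue m p ⬝ᵥ x := by have := (glue m).measurable; fun_prop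
  have h1 := integral_convolution (ContinuousLinearMap.mul ℂ ℂ) (hg.mul_eiRe hgl)
    (hh.mul_eiRe hgl)
  simp only [ContinuousLinearMap.mul_apply'] at h1
  rw [Pi.mul_apply, splitFourier_apply, splitFourier_apply, splitFourier_apply, ← h1]
  congr 1; funext p
  rw [splitConvolution_apply, convolution_def, ← integral_mul_const]
  congr 1; funext q
  have h2 : eiRe (glue m p ⬝ᵥ x) = eiRe (glue m q ⬝ᵥ x) * eiRe (glue m (p - q) ⬝ᵥ x) := by
    rw [← eiRe_add, ← add_dotProduct, ← glue_add, add_sub_cancel]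
  rw [h2, ContinuousLinearMap.mul_apply']
  ring

/-- The transform in `ξ` makes the convolution a product in that variable and leaves a convolution
in `c`. The exceptional set of `c` does not depend on `y`, because the character has modulus 1 and
does not affect integrability. -/
theorem fiberFourier_splitConvolution (hg : Integrable g (splitMeasure m))
    (hh : Integrable h (splitMeasure m)) :
    ∀ᵐ c ∂cMeasure, ∀ y, fiberFourier (splitConvolution g h) (c, y) =
      ∫ c', fiberFourier g (c', y) * fiberFourier h (c - c', y) ∂cMeasure := by
  have h1 := hg.convolution_integrand (ContinuousLinearMap.mul ℂ ℂ) hh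
  have h2 := ((measurePreserving_prodAssoc cMeasure (cnMeasure m)
    (splitMeasure m)).symm _).integrable_comp_of_integrable h1
  filter_upwards [h2.prod_right_ae] with c hc y
  have hc' : Integrable (fun r : (Fin m → ℂ) × (ℂ × (Fin m → ℂ)) =>
      g r.2 * h ((c, r.1) - r.2) * eiRe (r.1 ⬝ᵥ y)) ((cnMeasure m).prod (splitMeasure m)) :=
    Integrable.mul_eiRe hc (by fun_prop)
  have h3 : fiberFourier (splitConvolution g h) (c, y) =
      ∫ ξ, ∫ q, g q * h ((c, ξ) - q) * eiRe (ξ ⬝ᵥ y) ∂splitMeasure m ∂cnMeasure m := by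
    simp only [fiberFourier, piFourier, splitConvolution_apply, ← integral_mul_const]
  have h4 : ∀ q : ℂ × (Fin m → ℂ), ∫ ξ, g q * h ((c, ξ) - q) * eiRe (ξ ⬝ᵥ y) ∂cnMeasure m =
      g q * eiRe (q.2 ⬝ᵥ y) * fiberFourier h (c - q.1, y) := by
    intro q
    rw [← integral_add_right_eq_self _ q.2, fiberFourier, piFourier, ← integral_const_mul]
    congr 1; funext ξ
    have h6 : ((c, ξ + q.2) : ℂ × (Fin m → ℂ)) - q = (c - q.1, ξ) := by ext <;> simp
    rw [h6, add_dotProduct, eiRe_add]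
    ring
  have h5 := hc'.integral_prod_right
  simp only [h4] at h5
  rw [h3, integral_integral_swap hc']
  simp_rw [h4]
  rw [integral_prod _ h5]
  congr 1; funext c'
  simp only
  rw [integral_mul_const]
  rfl

theorem lintegral_enorm_fiberFourier_le (hh : AEStronglyMeasurable h (splitMeasure m))
    (y : Fin m → ℂ) :
    ∫⁻ c, ‖fiberFourier h (c, y)‖ₑ ∂cMeasure ≤ ∫⁻ p, ‖h p‖ₑ ∂splitMeasure m := by
  rw [lintegral_prod _ hh.enorm]
  refine lintegral_mono fun c => ?_
  refine (enorm_integral_le_lintegral_enorm _).trans (le_of_eq ?_)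
  congr 1; funext ξ
  rw [enorm_mul, ← ofReal_norm (eiRe _), norm_eiRe, ENNReal.ofReal_one, mul_one]

theorem enorm_add_pow_le (m : ℕ) (a b : ℂ) :
    ‖a + b‖ₑ ^ m ≤ 2 ^ m * (‖a‖ₑ ^ m + ‖b‖ₑ ^ m) := by
  have h1 : ‖a + b‖ₑ ≤ 2 * max ‖a‖ₑ ‖b‖ₑ := by
    refine (enorm_add_le a b).trans ?_
    rw [two_mul]
    exact add_le_add (le_max_left _ _) (le_max_right _ _)
  calc ‖a + b‖ₑ ^ m ≤ (2 * max ‖a‖ₑ ‖b‖ₑ) ^ m := by gcongr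
    _ = 2 ^ m * (max ‖a‖ₑ ‖b‖ₑ) ^ m := mul_pow _ _ _
    _ ≤ 2 ^ m * (‖a‖ₑ ^ m + ‖b‖ₑ ^ m) := by
      gcongr
      rcases max_choice ‖a‖ₑ ‖b‖ₑ with h | h <;> rw [h]
      · exact le_self_add
      · exact le_add_self

/-- At fixed `y` the transform is a convolution in `c`, and `enorm_add_pow_le` places the weight on
one of the two factors. The other factor, integrated in `c`, is bounded by an `L¹` norm uniformly in
`y`, so integrating over `y` involves only the weighted factor. -/
theorem lintegral_fiber_splitConvolution_lt_top (hg : RadonAdmissible g) (hh : RadonAdmissible h)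
    (hgm : StronglyMeasurable g) (hhm : StronglyMeasurable h) :
    ∫⁻ p, ‖p.1‖ₑ ^ m * ‖fiberFourier (splitConvolution g h) p‖ₑ ∂splitMeasure m < ⊤ := by
  have hG := (stronglyMeasurable_fiberFourier hgm).measurable.enorm
  have hH := (stronglyMeasurable_fiberFourier hhm).measurable.enorm
  set G := fun p => ‖fiberFourier g p‖ₑ
  set H := fun p => ‖fiberFourier h p‖ₑ
  set Ng := ∫⁻ p, ‖g p‖ₑ ∂splitMeasure m
  set Nh := ∫⁻ p, ‖h p‖ₑ ∂splitMeasure m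
  have h1 : ∀ᵐ p ∂splitMeasure m, ‖p.1‖ₑ ^ m * ‖fiberFourier (splitConvolution g h) p‖ₑ ≤
      ∫⁻ c', ‖p.1‖ₑ ^ m * (G (c', p.2) * H (p.1 - c', p.2)) ∂cMeasure := by
    filter_upwards [ae_fst_splitMeasure
      (fiberFourier_splitConvolution hg.integrable hh.integrable)] with p hp
    rw [lintegral_const_mul' _ _ (by simp), ← Prod.mk.eta (p := p), hp]
    gcongr
    refine (enorm_integral_le_lintegral_enorm _).trans (le_of_eq ?_)
    simp only [enorm_mul, G, H]
  have hW : ∀ {k : ℂ × (Fin m → ℂ) → ENNReal}, Measurable k →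
      ∫⁻ p, ‖p.1‖ₑ ^ m * k p ∂splitMeasure m =
        ∫⁻ y, ∫⁻ c, ‖c‖ₑ ^ m * k (c, y) ∂cMeasure ∂cnMeasure m := fun hk =>
    lintegral_prod_symm' _ (by fun_prop)
  have h2 : ∀ y, ∫⁻ c, ∫⁻ c', ‖c‖ₑ ^ m * (G (c', y) * H (c - c', y)) ∂cMeasure ∂cMeasure ≤
      2 ^ m * ((∫⁻ c, ‖c‖ₑ ^ m * G (c, y) ∂cMeasure) * Nh +
        Ng * ∫⁻ c, ‖c‖ₑ ^ m * H (c, y) ∂cMeasure) := by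
    intro y
    have h3 : ∀ c', ∫⁻ c, ‖c‖ₑ ^ m * (G (c', y) * H (c - c', y)) ∂cMeasure ≤
        2 ^ m * (‖c'‖ₑ ^ m * G (c', y) * Nh +
          G (c', y) * ∫⁻ c, ‖c‖ₑ ^ m * H (c, y) ∂cMeasure) := by
      intro c'
      rw [← lintegral_add_right_eq_self _ c']
      calc ∫⁻ c, ‖c + c'‖ₑ ^ m * (G (c', y) * H (c + c' - c', y)) ∂cMeasure
          ≤ ∫⁻ c, 2 ^ m * (‖c'‖ₑ ^ m * G (c', y) * H (c, y) +
              G (c', y) * (‖c‖ₑ ^ m * H (c, y))) ∂cMeasure := by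
            refine lintegral_mono fun c => ?_
            rw [add_sub_cancel_right]
            refine (mul_le_mul_left (enorm_add_pow_le m c c') _).trans (le_of_eq ?_)
            ring
        _ = 2 ^ m * (‖c'‖ₑ ^ m * G (c', y) * ∫⁻ c, H (c, y) ∂cMeasure +
              G (c', y) * ∫⁻ c, ‖c‖ₑ ^ m * H (c, y) ∂cMeasure) := by
            rw [lintegral_const_mul _ (by fun_prop), lintegral_add_left (by fun_prop),
              lintegral_const_mul _ (by fun_prop), lintegral_const_mul _ (by fun_prop)]
        _ ≤ _ := by
            gcongr
            exact lintegral_enorm_fiberFourier_le hhm.aestronglyMeasurable y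
    rw [lintegral_lintegral_swap (by fun_prop)]
    refine (lintegral_mono h3).trans ?_
    rw [lintegral_const_mul _ (by fun_prop), lintegral_add_left (by fun_prop),
      lintegral_mul_const _ (by fun_prop), lintegral_mul_const _ (by fun_prop)]
    gcongr
    exact lintegral_enorm_fiberFourier_le hgm.aestronglyMeasurable y
  have hNg : Ng < ⊤ := hg.integrable.2
  have hNh : Nh < ⊤ := hh.integrable.2
  have hWg := hg.lintegral_lt_top
  have hWh := hh.lintegral_lt_top
  rw [hW hG] at hWg
  rw [hW hH] at hWh
  refine (lintegral_mono_ae h1).trans_lt ?_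
  rw [lintegral_prod_symm' _ (by
    refine Measurable.lintegral_prod_right (f := fun (p : ℂ × (Fin m → ℂ)) c' =>
      ‖p.1‖ₑ ^ m * (G (c', p.2) * H (p.1 - c', p.2))) ?_
    simp only [Function.uncurry_def]
    fun_prop)]
  refine (lintegral_mono h2).trans_lt ?_
  rw [lintegral_const_mul _ (by fun_prop), lintegral_add_left (by fun_prop),
    lintegral_mul_const _ (by fun_prop), lintegral_const_mul _ (by fun_prop)]
  exact ENNReal.mul_lt_top (by simp) (ENNReal.add_lt_top.2
    ⟨ENNReal.mul_lt_top hWg hNh, ENNReal.mul_lt_top hNg hWh⟩)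

theorem RadonAdmissible.memLp_splitFourier (hh : RadonAdmissible h) :
    MemLp (splitFourier h) 2 (cnMeasure (m + 1)) :=
  ⟨(continuous_splitFourier hh.integrable).aestronglyMeasurable, by
    rw [eLpNorm_splitFourier hh.integrable]; exact hh.memLp_two.2⟩

theorem RadonAdmissible.exists_splitFourier_mul (hg : RadonAdmissible g)
    (hh : RadonAdmissible h) :
    ∃ k, RadonAdmissible k ∧ splitFourier k = splitFourier g * splitFourier h := by
  have hgm := hg.integrable.1
  have hhm := hh.integrable.1
  have hg' := hg.congr_ae hgm.ae_eq_mk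
  have hh' := hh.congr_ae hhm.ae_eq_mk
  rw [splitFourier_congr_ae hgm.ae_eq_mk, splitFourier_congr_ae hhm.ae_eq_mk,
    ← splitFourier_splitConvolution hg'.integrable hh'.integrable]
  have hi := integrable_splitConvolution hg'.integrable hh'.integrable
  refine ⟨_, ⟨hi, ⟨hi.1, ?_⟩, lintegral_fiber_splitConvolution_lt_top hg' hh'
    hgm.stronglyMeasurable_mk hhm.stronglyMeasurable_mk⟩, rfl⟩
  rw [← eLpNorm_splitFourier hi, splitFourier_splitConvolution hg'.integrable hh'.integrable]
  -- By Plancherel the convolution is in `L²` as soon as its transform is, and that transform is a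
  -- bounded function times an `L²` function.
  refine (MemLp.of_le_mul (c := ∫ ξ, ‖(hgm.mk g ∘ (glue m).symm) ξ‖ ∂cnMeasure (m + 1))
    hh'.memLp_splitFourier ?_ (Filter.Eventually.of_forall fun x => ?_)).2
  · exact ((continuous_splitFourier hg'.integrable).mul
      (continuous_splitFourier hh'.integrable)).aestronglyMeasurable
  · rw [Pi.mul_apply, norm_mul]
    gcongr
    exact norm_piFourier_le _ _

end SplitConvolution

/-! ## The Fourier transform on `ℂ` -/

theorem measurePreserving_funUnique_cMeasure :
    MeasurePreserving (MeasurableEquiv.funUnique (Fin 1) ℂ) (cnMeasure 1) cMeasure := by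
  have h := volume_preserving_funUnique (Fin 1) ℂ
  refine ⟨h.measurable, ?_⟩
  rw [cnMeasure, cMeasure, Measure.map_smul, pow_one]
  exact congrArg (fun μ => ENNReal.ofReal (2 * Real.pi)⁻¹ • μ) h.map_eq

theorem piFourier_comp_funUnique (φ : ℂ → ℂ) (y : Fin 1 → ℂ) :
    piFourier (φ ∘ MeasurableEquiv.funUnique (Fin 1) ℂ) y =
      ∫ c, φ c * eiRe (c * y 0) ∂cMeasure := by
  rw [piFourier, ← measurePreserving_funUnique_cMeasure.integral_comp
    (MeasurableEquiv.measurableEmbedding _)]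
  simp [dotProduct]

theorem ae_eq_of_integral_mul_eiRe_eq {φ ψ : ℂ → ℂ} (hφ : Integrable φ cMeasure)
    (hψ : Integrable ψ cMeasure)
    (H : ∀ t, ∫ c, φ c * eiRe (c * t) ∂cMeasure = ∫ c, ψ c * eiRe (c * t) ∂cMeasure) :
    φ =ᵐ[cMeasure] ψ := by
  have hp := measurePreserving_funUnique_cMeasure
  have h1 := ae_eq_of_piFourier_eq (hp.integrable_comp_of_integrable hφ)
    (hp.integrable_comp_of_integrable hψ) (by
      funext y
      rw [piFourier_comp_funUnique, piFourier_comp_funUnique, H])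
  simpa [Function.comp_def] using (hp.symm _).quasiMeasurePreserving.ae_eq_comp h1

theorem cFourier_apply_eiRe (ψ : 𝓢(ℂ, ℂ)) (t : ℂ) :
    cFourier ψ t = ∫ c, ψ c * eiRe (c * t) ∂cMeasure :=
  cFourier_apply ψ t

theorem cFourier_cFourier (ψ : 𝓢(ℂ, ℂ)) (t : ℂ) : cFourier (cFourier ψ) t = ψ (-t) := by
  have h1 : ∀ (θ : 𝓢(ℂ, ℂ)) (y : Fin 1 → ℂ),
      schwartzFourier 1 (compCLMOfContinuousLinearEquiv ℂ
        (ContinuousLinearEquiv.funUnique (Fin 1) ℝ ℂ) θ) y = cFourier θ (y 0) := by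
    intro θ y
    rw [schwartzFourier_apply, cFourier_apply_eiRe, ← piFourier_comp_funUnique]
    rfl
  have h2 : compCLMOfContinuousLinearEquiv ℂ (ContinuousLinearEquiv.funUnique (Fin 1) ℝ ℂ)
      (cFourier ψ) = schwartzFourier 1 (compCLMOfContinuousLinearEquiv ℂ
        (ContinuousLinearEquiv.funUnique (Fin 1) ℝ ℂ) ψ) := by
    ext y
    rw [h1]
    rfl
  have h3 := h1 (cFourier ψ) fun _ => t
  rw [h2, schwartzFourier_schwartzFourier] at h3
  exact h3.symm

theorem cFourier_surjective : Function.Surjective cFourier := by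
  intro φ
  refine ⟨compCLMOfContinuousLinearEquiv ℂ (ContinuousLinearEquiv.neg ℝ) (cFourier φ), ?_⟩
  ext t
  rw [cFourier_apply_eiRe, ← integral_neg_eq_self]
  have h := cFourier_cFourier φ (-t)
  rw [cFourier_apply_eiRe, neg_neg] at h
  rw [← h]
  congr 1; funext c
  change cFourier φ (- -c) * _ = _
  rw [neg_neg, neg_mul, mul_neg]

/-! ## Schwartz functions belong to the test space -/

section Schwartz

variable {m : ℕ}

theorem integrable_schwartz_comp_glue (H : 𝓢(Fin (m + 1) → ℂ, ℂ)) :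
    Integrable (H ∘ glue m) (splitMeasure m) :=
  (measurePreserving_glue m).integrable_comp_of_integrable H.integrable

theorem splitFourier_schwartz (H : 𝓢(Fin (m + 1) → ℂ, ℂ)) :
    splitFourier (H ∘ glue m) = schwartzFourier (m + 1) H := by
  funext x
  rw [schwartzFourier_apply, splitFourier]
  congr 1
  funext p
  simp

theorem integrable_fiberFourier_left {h : ℂ × (Fin m → ℂ) → ℂ}
    (hh : Integrable h (splitMeasure m)) (y : Fin m → ℂ) :
    Integrable (fun c => fiberFourier h (c, y)) cMeasure :=
  (hh.mul_eiRe (g := fun p => p.2 ⬝ᵥ y) (by fun_prop)).integral_prod_left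

theorem lintegral_weight_mul_enorm_fiberFourier_le (j : ℕ) {h : ℂ × (Fin m → ℂ) → ℂ}
    (hh : AEStronglyMeasurable h (splitMeasure m)) (y : Fin m → ℂ) :
    ∫⁻ c, ‖c‖ₑ ^ j * ‖fiberFourier h (c, y)‖ₑ ∂cMeasure ≤
      ∫⁻ p, ‖p.1‖ₑ ^ j * ‖h p‖ₑ ∂splitMeasure m := by
  rw [lintegral_prod (fun p => ‖p.1‖ₑ ^ j * ‖h p‖ₑ)
    ((by fun_prop : AEMeasurable _ _).mul hh.enorm)]
  refine lintegral_mono fun c => ?_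
  simp only
  rw [lintegral_const_mul' _ _ (by simp)]
  gcongr
  refine (enorm_integral_le_lintegral_enorm _).trans (le_of_eq ?_)
  congr 1; funext ξ
  rw [enorm_mul, ← ofReal_norm (eiRe _), norm_eiRe, ENNReal.ofReal_one, mul_one]

theorem norm_fst_le_norm_glue (p : ℂ × (Fin m → ℂ)) : ‖p.1‖ ≤ ‖glue m p‖ := by
  have h := norm_le_pi_norm (glue m p) (Fin.last m)
  rwa [glue_apply, Fin.snoc_last, ← glue_apply] at h

theorem lintegral_weight_mul_schwartz_lt_top (j : ℕ) (H : 𝓢(Fin (m + 1) → ℂ, ℂ)) :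
    ∫⁻ p, ‖p.1‖ₑ ^ j * ‖(H ∘ glue m) p‖ₑ ∂splitMeasure m < ⊤ := by
  have h1 := (measurePreserving_glue m).integrable_comp_of_integrable
    (H.integrable_pow_mul (cnMeasure (m + 1)) j)
  refine lt_of_le_of_lt (lintegral_mono fun p => ?_) h1.2
  simp only [Function.comp_apply]
  rw [enorm_mul, enorm_pow, enorm_norm, enorm_norm]
  gcongr
  rw [← ofReal_norm, ← ofReal_norm]
  exact ENNReal.ofReal_le_ofReal (norm_fst_le_norm_glue p)

/-- The function `(y, s) ↦ (1 + |y|²) ^ l` on `ℂ ^ (m + 1)`. -/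
noncomputable def initWeight (l : ℕ) (x : Fin (m + 1) → ℂ) : ℂ :=
  ((1 + ‖toEuclid m fun i => x i.castSucc‖ ^ 2 : ℝ) : ℂ) ^ l

theorem hasTemperateGrowth_initWeight (l : ℕ) :
    (initWeight l : (Fin (m + 1) → ℂ) → ℂ).HasTemperateGrowth := by
  have h1 : Function.HasTemperateGrowth fun x : Fin (m + 1) → ℂ =>
      toEuclid m fun i => x i.castSucc :=
    ((toEuclid m).toContinuousLinearMap.comp (ContinuousLinearMap.pi fun i : Fin m =>
      ContinuousLinearMap.proj (R := ℝ) (φ := fun _ : Fin (m + 1) => ℂ)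
        i.castSucc)).hasTemperateGrowth
  have h2 : Function.HasTemperateGrowth fun x : Fin (m + 1) → ℂ =>
      ‖toEuclid m fun i => x i.castSucc‖ ^ 2 :=
    (Function.hasTemperateGrowth_norm_sq (H := EuclideanSpace ℂ (Fin m))).comp h1
  have h3 := (Function.HasTemperateGrowth.const (E := Fin (m + 1) → ℂ) (1 : ℝ)).add h2
  exact (Complex.ofRealCLM.hasTemperateGrowth.comp h3).pow l

/-- Multiplying the transform of `H` by `(1 + |y|²)^l` gives the transform of another Schwartz
function `H₂`. Estimating the fibre transform of `H₂` uniformly in `y` then yields decay in `y` for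
that of `H`; `l` is chosen so that this decay is integrable. -/
theorem lintegral_weight_mul_fiberFourier_schwartz_lt_top (j : ℕ)
    (H : 𝓢(Fin (m + 1) → ℂ, ℂ)) :
    ∫⁻ p, ‖p.1‖ₑ ^ j * ‖fiberFourier (H ∘ glue m) p‖ₑ ∂splitMeasure m < ⊤ := by
  obtain ⟨l, hl⟩ := (inferInstance : (cnMeasure m).HasTemperateGrowth).exists_integrable
  obtain ⟨H₂, hH₂⟩ := schwartzFourier_surjective (m + 1)
    (smulLeftCLM ℂ (initWeight l) (schwartzFourier (m + 1) H))
  set P : (Fin m → ℂ) → ℂ := fun y => ((1 + ‖toEuclid m y‖ ^ 2 : ℝ) : ℂ) ^ l with hP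
  have hi := integrable_schwartz_comp_glue H
  have hi₂ := integrable_schwartz_comp_glue H₂
  -- For fixed `y` both sides have the same Fourier transform in `c`. The null set may depend on
  -- `y`, which is harmless because `y` is the outer variable of integration below.
  have key : ∀ y, ∀ᵐ c ∂cMeasure, fiberFourier (H₂ ∘ glue m) (c, y) =
      P y * fiberFourier (H ∘ glue m) (c, y) := by
    intro y
    refine ae_eq_of_integral_mul_eiRe_eq (integrable_fiberFourier_left hi₂ y)
      ((integrable_fiberFourier_left hi y).const_mul _) fun s => ?_
    have h1 := splitFourier_snoc hi₂ y s
    have h2 := splitFourier_snoc hi y s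
    rw [splitFourier_schwartz] at h1 h2
    simp_rw [mul_assoc]
    rw [integral_const_mul]
    refine h1.symm.trans ?_
    refine Eq.trans ?_ (congrArg (P y * ·) h2)
    rw [hH₂, smulLeftCLM_apply_apply (hasTemperateGrowth_initWeight l)]
    simp [initWeight, hP]
  have hP0 : ∀ y, ‖P y‖ₑ ≠ 0 := by
    intro y
    rw [enorm_ne_zero]
    refine pow_ne_zero _ ?_
    rw [Complex.ofReal_ne_zero]
    positivity
  set M := ∫⁻ p, ‖p.1‖ₑ ^ j * ‖(H₂ ∘ glue m) p‖ₑ ∂splitMeasure m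
  have hM : M < ⊤ := lintegral_weight_mul_schwartz_lt_top j H₂
  have h3 : ∀ y, ∫⁻ c, ‖c‖ₑ ^ j * ‖fiberFourier (H ∘ glue m) (c, y)‖ₑ ∂cMeasure ≤
      ‖P y‖ₑ⁻¹ * M := by
    intro y
    rw [mul_comm, ← div_eq_mul_inv, ENNReal.le_div_iff_mul_le (Or.inl (hP0 y))
      (Or.inl enorm_ne_top), mul_comm, ← lintegral_const_mul' _ _ enorm_ne_top]
    refine le_trans (le_of_eq (lintegral_congr_ae ?_))
      (lintegral_weight_mul_enorm_fiberFourier_le j hi₂.1 y)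
    filter_upwards [key y] with c hc
    rw [hc, enorm_mul]
    ring
  -- The constant `2 ^ l` comes from `1 + r ≤ 2 (1 + r²)` with `r` the Euclidean norm, which
  -- dominates the sup norm.
  have h4 : ∀ y, ‖P y‖ₑ⁻¹ ≤ 2 ^ l * ‖(1 + ‖y‖) ^ (-(l : ℝ))‖ₑ := by
    intro y
    have h5 : ‖y‖ ≤ ‖toEuclid m y‖ := by
      refine (pi_norm_le_iff_of_nonneg (norm_nonneg _)).2 fun i => ?_
      exact PiLp.norm_apply_le (toEuclid m y) i
    have h6 : 1 + ‖y‖ ≤ 2 * (1 + ‖toEuclid m y‖ ^ 2) := by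
      nlinarith [sq_nonneg (‖toEuclid m y‖ - 1), norm_nonneg (toEuclid m y)]
    have h7 : ‖P y‖⁻¹ ≤ 2 ^ l * (1 + ‖y‖) ^ (-(l : ℝ)) := by
      have h8 : ‖P y‖ = (1 + ‖toEuclid m y‖ ^ 2) ^ l := by
        rw [hP, norm_pow, Complex.norm_real, Real.norm_of_nonneg (by positivity)]
      rw [h8, Real.rpow_neg (by positivity), Real.rpow_natCast, ← div_eq_mul_inv,
        inv_le_comm₀ (by positivity) (by positivity), inv_div, div_le_iff₀ (by positivity),
        mul_comm, ← mul_pow]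
      gcongr
    have h9 : ‖P y‖ ≠ 0 := norm_ne_zero_iff.2 (enorm_ne_zero.1 (hP0 y))
    rw [← ofReal_norm (P y), ← ENNReal.ofReal_inv_of_pos (by positivity),
      ← ofReal_norm ((1 + ‖y‖) ^ (-(l : ℝ))), Real.norm_of_nonneg (by positivity)]
    refine (ENNReal.ofReal_le_ofReal h7).trans (le_of_eq ?_)
    rw [ENNReal.ofReal_mul (by positivity), ENNReal.ofReal_pow (by norm_num), ENNReal.ofReal_ofNat]
  rw [lintegral_prod_symm (fun p => ‖p.1‖ₑ ^ j * ‖fiberFourier (H ∘ glue m) p‖ₑ) ((by fun_prop : AEMeasurable _ _).mul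
    (aestronglyMeasurable_fiberFourier hi.1).enorm)]
  refine (lintegral_mono fun y => (h3 y).trans (mul_le_mul_left (h4 y) M)).trans_lt ?_
  rw [lintegral_mul_const' _ _ hM.ne, lintegral_const_mul' _ _ (by simp)]
  exact ENNReal.mul_lt_top (ENNReal.mul_lt_top (by simp) hl.2) hM

theorem radonAdmissible_schwartz (H : 𝓢(Fin (m + 1) → ℂ, ℂ)) :
    RadonAdmissible (H ∘ glue m) where
  integrable := integrable_schwartz_comp_glue H
  memLp_two := (H.memLp 2 _).comp_measurePreserving (measurePreserving_glue m)
  lintegral_lt_top := lintegral_weight_mul_fiberFourier_schwartz_lt_top m H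

theorem integrable_fiberFourier_schwartz (H : 𝓢(Fin (m + 1) → ℂ, ℂ)) :
    Integrable (fiberFourier (H ∘ glue m)) (splitMeasure m) :=
  ⟨aestronglyMeasurable_fiberFourier (integrable_schwartz_comp_glue H).1, by
    simpa using! lintegral_weight_mul_fiberFourier_schwartz_lt_top 0 H⟩

/-! ## The transform of a Schwartz function -/

/-- Both sides are continuous in `ξ`, which upgrades inversion from almost every `ξ` to every `ξ`.
This is needed because `ξ` is later a prescribed multiple of a fixed vector. -/
theorem ae_piFourier_fiberFourier_schwartz (H : 𝓢(Fin (m + 1) → ℂ, ℂ)) :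
    ∀ᵐ c ∂cMeasure, ∀ ξ, piFourier (fun y => fiberFourier (H ∘ glue m) (c, y)) (-ξ) =
      H (glue m (c, ξ)) := by
  have hA := radonAdmissible_schwartz H
  filter_upwards [hA.fiber_inversion, hA.fiber_integrable] with c hc hi ξ
  have h1 : Continuous fun ξ => H (glue m (c, ξ)) := by
    simp only [glue_apply]
    fun_prop
  have h2 : Continuous fun ξ => piFourier (fun y => fiberFourier (H ∘ glue m) (c, y)) (-ξ) :=
    (continuous_piFourier hi.2).comp continuous_neg
  exact congrFun ((h2.ae_eq_iff_eq (cnMeasure m) h1).1 hc) ξ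

theorem splitFourier_radonMul_schwartz {w : ℂ → ℂ} (hw : IsRadonMultiplier m w) {ε : ℂ}
    (hε : ε * ε = 1) (H : 𝓢(Fin (m + 1) → ℂ, ℂ)) (b : Fin m → ℂ) (s : ℂ) :
    splitFourier (radonMul w ε (H ∘ glue m)) (Fin.snoc b s : Fin (m + 1) → ℂ) =
      ∫ c, w c * (H (glue m (c, -((ε * c) • b))) * eiRe (c * s)) ∂cMeasure := by
  rw [splitFourier_snoc ((radonAdmissible_schwartz H).radonMul hw hε).integrable]
  refine integral_congr_ae ?_
  filter_upwards [ae_piFourier_fiberFourier_schwartz H, ae_cMeasure_ne_zero] with c hc hc0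
  have h1 := fiberFourier_radonMul (w := w) hε hc0 (H ∘ glue m) b
  rw [← hc, neg_neg, ← mul_assoc, ← h1]
  rfl

/-- Integrals of a Schwartz function over parallel hyperplanes in terms of its Fourier transform. -/
theorem integral_schwartzFourier_hyperplane (H : 𝓢(Fin (m + 1) → ℂ, ℂ)) (p : Fin m → ℂ) (r : ℂ) :
    Integrable (fun c => H (glue m (c, -(c • p)))) cMeasure ∧
    ∫ y, schwartzFourier (m + 1) H (Fin.snoc y (p ⬝ᵥ y + r) : Fin (m + 1) → ℂ) ∂cnMeasure m =
      ∫ c, H (glue m (c, -(c • p))) * eiRe (c * r) ∂cMeasure := by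
  have hk := integrable_fiberFourier_schwartz H
  -- On the hyperplane the phase is `e(y · (c p)) e(c r)`, so the integral over `y` is a fibre
  -- inversion evaluated at `ξ = -(c p)`.
  have h1 : ∀ᵐ c ∂cMeasure, ∀ r, ∫ y, fiberFourier (H ∘ glue m) (c, y) *
      eiRe (c * (p ⬝ᵥ y + r)) ∂cnMeasure m = H (glue m (c, -(c • p))) * eiRe (c * r) := by
    filter_upwards [ae_piFourier_fiberFourier_schwartz H] with c hc r
    rw [← hc, neg_neg, piFourier, ← integral_mul_const]
    congr 1; funext y
    rw [mul_add, eiRe_add, ← mul_assoc, dotProduct_smul, smul_eq_mul, dotProduct_comm y]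
  have h2 : ∀ r, Integrable (fun q : ℂ × (Fin m → ℂ) => fiberFourier (H ∘ glue m) q *
      eiRe (q.1 * (p ⬝ᵥ q.2 + r))) (splitMeasure m) := fun r => hk.mul_eiRe (by fun_prop)
  constructor
  -- At `r = 0` the extra phase is 1, so integrability of the slice itself comes from Fubini.
  · refine (h2 0).integral_prod_left.congr ?_
    filter_upwards [h1] with c hc
    rw [hc, mul_zero, eiRe_zero, mul_one]
  · have h3 : ∀ y, schwartzFourier (m + 1) H (Fin.snoc y (p ⬝ᵥ y + r) : Fin (m + 1) → ℂ) =
        ∫ c, fiberFourier (H ∘ glue m) (c, y) * eiRe (c * (p ⬝ᵥ y + r)) ∂cMeasure := by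
      intro y
      rw [← splitFourier_schwartz, splitFourier_snoc (integrable_schwartz_comp_glue H)]
      rfl
    simp_rw [h3]
    rw [← integral_integral_swap (h2 r)]
    refine integral_congr_ae ?_
    filter_upwards [h1] with c hc using hc r

end Schwartz

/-! ## The test space -/

section TestSpace

variable {m : ℕ}

theorem RadonAdmissible.add {g h : ℂ × (Fin m → ℂ) → ℂ} (hg : RadonAdmissible g)
    (hh : RadonAdmissible h) : RadonAdmissible (g + h) where
  integrable := hg.integrable.add hh.integrable
  memLp_two := hg.memLp_two.add hh.memLp_two
  lintegral_lt_top := by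
    refine lt_of_le_of_lt (lintegral_mono_ae (g := fun p => ‖p.1‖ₑ ^ m * ‖fiberFourier g p‖ₑ +
      ‖p.1‖ₑ ^ m * ‖fiberFourier h p‖ₑ) ?_) ?_
    · filter_upwards [ae_fst_splitMeasure (ae_fiberFourier_add hg.integrable hh.integrable)]
        with p hp
      rw [← mul_add, ← Prod.mk.eta (p := p), hp]
      gcongr
      exact enorm_add_le _ _
    · have hm : AEMeasurable (fun p => ‖p.1‖ₑ ^ m * ‖fiberFourier g p‖ₑ) (splitMeasure m) :=
        (by fun_prop : AEMeasurable _ _).mul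
          (aestronglyMeasurable_fiberFourier hg.integrable.1).enorm
      rw [lintegral_add_left' hm]
      exact ENNReal.add_lt_top.2 ⟨hg.lintegral_lt_top, hh.lintegral_lt_top⟩

theorem RadonAdmissible.smul {h : ℂ × (Fin m → ℂ) → ℂ} (a : ℂ) (hh : RadonAdmissible h) :
    RadonAdmissible (a • h) where
  integrable := hh.integrable.smul a
  memLp_two := hh.memLp_two.const_smul a
  lintegral_lt_top := by
    simp_rw [fiberFourier_smul, enorm_mul, mul_left_comm _ ‖a‖ₑ]
    rw [lintegral_const_mul' _ _ enorm_ne_top]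
    exact ENNReal.mul_lt_top enorm_lt_top hh.lintegral_lt_top

variable (m) in
/-- The test space of the Radon transforms. -/
noncomputable def radonAlgebra : NonUnitalSubalgebra ℂ ((Fin (m + 1) → ℂ) → ℂ) where
  carrier := {f | ∃ h, RadonAdmissible h ∧ splitFourier h = f}
  add_mem' := by
    rintro _ _ ⟨g, hg, rfl⟩ ⟨h, hh, rfl⟩
    exact ⟨g + h, hg.add hh, splitFourier_add hg.integrable hh.integrable⟩
  zero_mem' := by
    refine ⟨(0 : ℂ) • ((0 : 𝓢(Fin (m + 1) → ℂ, ℂ)) ∘ glue m),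
      (radonAdmissible_schwartz 0).smul 0, ?_⟩
    rw [splitFourier_smul, zero_smul]
  mul_mem' := by
    rintro _ _ ⟨g, hg, rfl⟩ ⟨h, hh, rfl⟩
    exact hg.exists_splitFourier_mul hh
  smul_mem' := by
    rintro a _ ⟨h, hh, rfl⟩
    exact ⟨a • h, hh.smul a, splitFourier_smul a h⟩

theorem splitFourier_mem_radonAlgebra {h : ℂ × (Fin m → ℂ) → ℂ} (hh : RadonAdmissible h) :
    splitFourier h ∈ radonAlgebra m := ⟨h, hh, rfl⟩

theorem schwartz_mem_radonAlgebra (f : 𝓢(Fin (m + 1) → ℂ, ℂ)) :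
    (f : (Fin (m + 1) → ℂ) → ℂ) ∈ radonAlgebra m := by
  obtain ⟨H, rfl⟩ := schwartzFourier_surjective (m + 1) f
  exact ⟨_, radonAdmissible_schwartz H, splitFourier_schwartz H⟩

theorem continuous_of_mem_radonAlgebra {f : (Fin (m + 1) → ℂ) → ℂ} (hf : f ∈ radonAlgebra m) :
    Continuous f := by
  obtain ⟨h, hh, rfl⟩ := hf
  exact continuous_splitFourier hh.integrable

theorem memLp_of_mem_radonAlgebra {f : (Fin (m + 1) → ℂ) → ℂ} (hf : f ∈ radonAlgebra m) :
    MemLp f 2 (cnMeasure (m + 1)) := by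
  obtain ⟨h, hh, rfl⟩ := hf
  exact hh.memLp_splitFourier

variable (m) in
/-- The inclusion of the test space in `L²`. -/
noncomputable def radonAlgebraToLp : radonAlgebra m →ₗ[ℂ] Lp ℂ 2 (cnMeasure (m + 1)) where
  toFun f := (memLp_of_mem_radonAlgebra f.2).toLp (f : (Fin (m + 1) → ℂ) → ℂ)
  map_add' _ _ := MemLp.toLp_add _ _
  map_smul' _ _ := MemLp.toLp_const_smul _ _

theorem coeFn_radonAlgebraToLp (f : radonAlgebra m) :
    radonAlgebraToLp m f =ᵐ[cnMeasure (m + 1)] (f : (Fin (m + 1) → ℂ) → ℂ) :=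
  (memLp_of_mem_radonAlgebra f.2).coeFn_toLp

theorem norm_radonAlgebraToLp (f : radonAlgebra m) :
    ‖radonAlgebraToLp m f‖ =
      (eLpNorm (f : (Fin (m + 1) → ℂ) → ℂ) 2 (cnMeasure (m + 1))).toReal :=
  Lp.norm_toLp _ (memLp_of_mem_radonAlgebra f.2)

variable (m) in
theorem denseRange_radonAlgebraToLp : DenseRange (radonAlgebraToLp m) := by
  refine (denseRange_toLp (m + 1)).mono ?_
  rintro _ ⟨f, rfl⟩
  exact ⟨⟨f, schwartz_mem_radonAlgebra f⟩, rfl⟩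

theorem neg_one_mul_neg_one : (-1 : ℂ) * -1 = 1 := by norm_num

/-! ## The Radon transform on the test space -/

/-- The Fourier transform of a function in the test space. -/
noncomputable def radonSymbol (f : radonAlgebra m) : ℂ × (Fin m → ℂ) → ℂ :=
  f.2.choose

theorem radonAdmissible_radonSymbol (f : radonAlgebra m) : RadonAdmissible (radonSymbol f) :=
  f.2.choose_spec.1

theorem splitFourier_radonSymbol (f : radonAlgebra m) : splitFourier (radonSymbol f) = f :=
  f.2.choose_spec.2

/-- The symbol is a choice, but injectivity of the Fourier transform makes it unique almost
everywhere; hence `radonMap` is linear and can be computed from any integrable symbol. -/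
theorem radonSymbol_ae_eq {h : ℂ × (Fin m → ℂ) → ℂ} (hh : Integrable h (splitMeasure m))
    {f : radonAlgebra m} (hf : splitFourier h = f) : radonSymbol f =ᵐ[splitMeasure m] h :=
  ae_eq_of_splitFourier_eq (radonAdmissible_radonSymbol f).integrable hh
    ((splitFourier_radonSymbol f).trans hf.symm)

variable {w : ℂ → ℂ} {ε : ℂ}

/-- The Radon transform on the test space. -/
noncomputable def radonMap (hw : IsRadonMultiplier m w) (hε : ε * ε = 1) :
    radonAlgebra m →ₗ[ℂ] radonAlgebra m where
  toFun f := ⟨splitFourier (radonMul w ε (radonSymbol f)),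
    splitFourier_mem_radonAlgebra ((radonAdmissible_radonSymbol f).radonMul hw hε)⟩
  map_add' f g := by
    have hf := radonAdmissible_radonSymbol f
    have hg := radonAdmissible_radonSymbol g
    have h1 : radonSymbol (f + g) =ᵐ[splitMeasure m] radonSymbol f + radonSymbol g := by
      refine radonSymbol_ae_eq (hf.integrable.add hg.integrable) ?_
      rw [splitFourier_add hf.integrable hg.integrable, splitFourier_radonSymbol,
        splitFourier_radonSymbol]
      rfl
    refine Subtype.ext ?_
    change splitFourier _ = splitFourier _ + splitFourier _
    rw [splitFourier_congr_ae ((radonMul_congr_ae h1).trans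
      (radonMul_add hf.integrable hg.integrable)),
      splitFourier_add (hf.radonMul hw hε).integrable (hg.radonMul hw hε).integrable]
  map_smul' a f := by
    have hf := radonAdmissible_radonSymbol f
    have h1 : radonSymbol (a • f) =ᵐ[splitMeasure m] a • radonSymbol f := by
      refine radonSymbol_ae_eq (hf.integrable.smul a) ?_
      rw [splitFourier_smul, splitFourier_radonSymbol]
      rfl
    refine Subtype.ext ?_
    change splitFourier _ = a • splitFourier _
    rw [splitFourier_congr_ae (radonMul_congr_ae h1), radonMul_smul, splitFourier_smul]

theorem radonMap_eq (hw : IsRadonMultiplier m w) (hε : ε * ε = 1)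
    {h : ℂ × (Fin m → ℂ) → ℂ} (hh : Integrable h (splitMeasure m)) {f : radonAlgebra m}
    (hf : splitFourier h = f) :
    (radonMap hw hε f : (Fin (m + 1) → ℂ) → ℂ) = splitFourier (radonMul w ε h) :=
  splitFourier_congr_ae (radonMul_congr_ae (radonSymbol_ae_eq hh hf))

theorem norm_radonAlgebraToLp_radonMap (hw : IsRadonMultiplier m w) (hε : ε * ε = 1)
    (f : radonAlgebra m) :
    ‖radonAlgebraToLp m (radonMap hw hε f)‖ = ‖radonAlgebraToLp m f‖ := by
  have hf := radonAdmissible_radonSymbol f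
  rw [norm_radonAlgebraToLp, norm_radonAlgebraToLp]
  congr 1
  rw [radonMap_eq hw hε hf.integrable (splitFourier_radonSymbol f),
    eLpNorm_splitFourier (hf.radonMul hw hε).integrable, eLpNorm_radonMul hw hε hf.integrable,
    ← eLpNorm_splitFourier hf.integrable, splitFourier_radonSymbol]

/-- Keeping `w'` and `ε'` as variables tied by equations lets one statement serve both composition
orders, `(w, 1)` with `(conj w, -1)` and the reverse. -/
theorem radonMap_conj_radonMap {w' : ℂ → ℂ} {ε' : ℂ} (hw : IsRadonMultiplier m w)
    (hε : ε * ε = 1) (hw' : IsRadonMultiplier m w') (hε' : ε' * ε' = 1)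
    (hc : w' = fun c => conj (w c)) (hn : ε' = -ε) (f : radonAlgebra m) :
    radonMap hw' hε' (radonMap hw hε f) = f := by
  subst hc hn
  have hf := radonAdmissible_radonSymbol f
  refine Subtype.ext ?_
  rw [radonMap_eq hw' hε' (hf.radonMul hw hε).integrable rfl,
    splitFourier_congr_ae (hf.radonMul_conj_radonMul hw hε), splitFourier_radonSymbol]

/-- The Radon transform on the test space as a linear equivalence. -/
noncomputable def radonEquiv (hw : IsRadonMultiplier m w) :
    radonAlgebra m ≃ₗ[ℂ] radonAlgebra m :=
  { radonMap hw (one_mul 1) with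
    invFun := radonMap hw.conj neg_one_mul_neg_one
    left_inv := radonMap_conj_radonMap hw _ hw.conj _ rfl rfl
    right_inv := radonMap_conj_radonMap hw.conj neg_one_mul_neg_one hw (one_mul 1)
      (by funext c; simp) (neg_neg 1).symm }

theorem radonEquiv_apply (hw : IsRadonMultiplier m w) (f : radonAlgebra m) :
    radonEquiv hw f = radonMap hw (one_mul 1) f := rfl

theorem radonEquiv_symm_apply (hw : IsRadonMultiplier m w) (f : radonAlgebra m) :
    (radonEquiv hw).symm f = radonMap hw.conj neg_one_mul_neg_one f := rfl

theorem norm_radonAlgebraToLp_radonEquiv (hw : IsRadonMultiplier m w) (f : radonAlgebra m) :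
    ‖radonAlgebraToLp m (radonEquiv hw f)‖ = ‖radonAlgebraToLp m f‖ :=
  norm_radonAlgebraToLp_radonMap hw (one_mul 1) f

/-- The Radon transform on `L²`. -/
noncomputable def radonL2 (hw : IsRadonMultiplier m w) :
    Lp ℂ 2 (cnMeasure (m + 1)) ≃ₗᵢ[ℂ] Lp ℂ 2 (cnMeasure (m + 1)) :=
  (radonEquiv hw).extendOfIsometry (radonAlgebraToLp m) (radonAlgebraToLp m)
    (denseRange_radonAlgebraToLp m) (denseRange_radonAlgebraToLp m)
    (norm_radonAlgebraToLp_radonEquiv hw)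

theorem radonL2_toLp (hw : IsRadonMultiplier m w) (f : radonAlgebra m) :
    radonL2 hw (radonAlgebraToLp m f) = radonAlgebraToLp m (radonEquiv hw f) :=
  LinearMap.extendOfNorm_eq (denseRange_radonAlgebraToLp m)
    ⟨1, fun g => ((norm_radonAlgebraToLp_radonEquiv hw g).trans (one_mul _).symm).le⟩ f

/-- The linear map that induces the topology of the test space: it makes the inclusion in `L²` and
the evaluations of a function and of its transform under `T` continuous. -/
noncomputable def radonEmbedding (T : radonAlgebra m →ₗ[ℂ] radonAlgebra m) :
    radonAlgebra m →ₗ[ℂ] Lp ℂ 2 (cnMeasure (m + 1)) × ((Fin (m + 1) → ℂ) → ℂ) ×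
      ((Fin (m + 1) → ℂ) → ℂ) :=
  (radonAlgebraToLp m).prod ((NonUnitalSubalgebra.toSubmodule (radonAlgebra m)).subtype.prod
    ((NonUnitalSubalgebra.toSubmodule (radonAlgebra m)).subtype ∘ₗ T))

/-- The test space with the topology induced by `radonEmbedding`. -/
noncomputable def radonTestAlgebra (T : radonAlgebra m →ₗ[ℂ] radonAlgebra m) :
    TestAlgebra (cnMeasure (m + 1)) :=
  letI t : TopologicalSpace (radonAlgebra m) := .induced (radonEmbedding T) inferInstance
  have hc : Continuous (radonEmbedding T) := continuous_induced_dom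
  { carrier := radonAlgebra m
    topology := t
    isTopologicalAddGroup := topologicalAddGroup_induced (radonEmbedding T)
    continuousSMul := continuousSMul_induced (radonEmbedding T)
    locallyConvex := LocallyConvexSpace.induced ((radonEmbedding T).restrictScalars ℝ)
    continuous_of_mem := fun _ => continuous_of_mem_radonAlgebra
    memLp := fun _ => memLp_of_mem_radonAlgebra
    dense := by
      refine (denseRange_radonAlgebraToLp m).mono ?_
      rintro _ ⟨f, rfl⟩
      exact ⟨f, f.2, coeFn_radonAlgebraToLp f⟩
    schwartz_mem := schwartz_mem_radonAlgebra
    continuous_toLp := continuous_fst.comp hc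
    continuous_eval := fun x =>
      (continuous_apply x).comp (continuous_fst.comp (continuous_snd.comp hc)) }

end TestSpace

/-! ## The kernels of the Radon transform and of its inverse -/

section Kernels

variable {m : ℕ} {u : 𝓢'(ℂ, ℂ)} {w : ℂ → ℂ}

/-! ### The Fourier side of `u` and of `conj u` -/

theorem HasFourierFunction.isRadonMultiplier (hw : HasFourierFunction u w)
    (habs : ∀ᵐ c ∂(volume : Measure ℂ), ‖w c‖ = ‖c‖ ^ m) : IsRadonMultiplier m w where
  aestronglyMeasurable := hw.1.aestronglyMeasurable
  norm_ae := ae_cMeasure_of_ae_volume habs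

/-- The density `θ` need not be Schwartz: `φ` is the transform of some Schwartz `ψ`, and uniqueness
forces `θ = ψ` almost everywhere. This lets `u` act on hyperplane integrals through their slice
representation. -/
theorem HasFourierFunction.apply_of_eq_integral (hw : HasFourierFunction u w) {θ : ℂ → ℂ}
    (hθ : Integrable θ cMeasure) {φ : 𝓢(ℂ, ℂ)}
    (hφ : ∀ t, φ t = ∫ c, θ c * eiRe (c * t) ∂cMeasure) : u φ = ∫ c, w c * θ c ∂cMeasure := by
  obtain ⟨ψ, rfl⟩ := cFourier_surjective φ
  rw [(hw.2 ψ).2]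
  refine integral_congr_ae ?_
  filter_upwards [ae_eq_of_integral_mul_eiRe_eq ψ.integrable hθ fun t =>
    (cFourier_apply_eiRe ψ t).symm.trans (hφ t)] with c hc
  rw [hc]

theorem schwartzConj_apply {E : Type*} [NormedAddCommGroup E] [NormedSpace ℝ E] (f : 𝓢(E, ℂ))
    (x : E) : schwartzConj f x = conj (f x) := rfl

/-- Conjugation turns the Fourier transform into its inverse. Consequently pairing `conj u` with `ψ`
is integration of `conj w` against the transform of `ψ`. -/
theorem cFourier_schwartzConj_cFourier (ψ : 𝓢(ℂ, ℂ)) :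
    cFourier (schwartzConj (cFourier ψ)) = schwartzConj ψ := by
  ext t
  have h := cFourier_cFourier ψ (-t)
  rw [neg_neg, cFourier_apply_eiRe] at h
  rw [schwartzConj_apply, ← h, ← integral_conj, cFourier_apply_eiRe]
  simp only [schwartzConj_apply, map_mul, conj_eiRe, mul_neg, neg_neg]

theorem HasFourierFunction.isFourierIntegral_distConj (hw : HasFourierFunction u w) :
    IsFourierIntegral (distConj u) fun c => conj (w c) := by
  intro ψ
  obtain ⟨h1, h2⟩ := hw.2 (schwartzConj (cFourier ψ))
  constructor
  · simpa [schwartzConj_apply] using Complex.conjCLE.toContinuousLinearMap.integrable_comp h1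
  · rw [distConj_apply, ← cFourier_schwartzConj_cFourier, h2, ← integral_conj]
    simp [schwartzConj_apply]

/-- Here `|c|^(2m) = w * conj w`, and `w` vanishes almost nowhere; this identifies `U` with `conj
u`. -/
theorem IsRadonMultiplier.inv_mul_ae_eq (hw : IsRadonMultiplier m w) :
    ∀ᵐ c ∂cMeasure, (w c)⁻¹ * (‖c‖ : ℂ) ^ (2 * m) = conj (w c) := by
  filter_upwards [hw.norm_ae, ae_cMeasure_ne_zero] with c hc hc0
  have h1 : w c ≠ 0 := norm_ne_zero_iff.1 (by rw [hc]; exact pow_ne_zero _ (norm_ne_zero_iff.2 hc0))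
  have h2 : (‖c‖ : ℂ) ^ (2 * m) = w c * conj (w c) := by
    rw [Complex.mul_conj', hc, mul_comm 2 m, pow_mul]
    push_cast; rfl
  rw [h2, inv_mul_cancel_left₀ h1]

theorem isFourierIntegral_congr_ae {U : 𝓢'(ℂ, ℂ)} {g h : ℂ → ℂ} (hgh : g =ᵐ[cMeasure] h) :
    IsFourierIntegral U g ↔ IsFourierIntegral U h := by
  refine forall_congr' fun ψ => ?_
  have h1 : (fun c => g c * cFourier ψ c) =ᵐ[cMeasure] fun c => h c * cFourier ψ c := by
    filter_upwards [hgh] with c hc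
    rw [hc]
  rw [integrable_congr h1, integral_congr_ae h1]

theorem IsFourierIntegral.unique {U V : 𝓢'(ℂ, ℂ)} {g : ℂ → ℂ} (hU : IsFourierIntegral U g)
    (hV : IsFourierIntegral V g) : U = V := by
  ext ψ
  rw [(hU ψ).2, (hV ψ).2]

/-! ### The kernels on Schwartz functions as integrals over `c` -/

theorem radonKernelX_snoc_schwartzFourier (hw : HasFourierFunction u w)
    (H : 𝓢(Fin (m + 1) → ℂ, ℂ)) (b : Fin m → ℂ) (s : ℂ) :
    radonKernelX u (Fin.snoc b s : Fin (m + 1) → ℂ) (schwartzFourier (m + 1) H) =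
      ∫ c, w c * (H (glue m (c, -(c • b))) * eiRe (c * s)) ∂cMeasure := by
  have hH := integral_schwartzFourier_hyperplane H b
  have h1 : radonKernelX u (Fin.snoc b s : Fin (m + 1) → ℂ) (schwartzFourier (m + 1) H) =
      u (planeIntegral 1 b s (schwartzFourier (m + 1) H)) := by
    simp only [radonKernelX, Fin.snoc_castSucc, Fin.snoc_last]
    rfl
  rw [h1]
  refine hw.apply_of_eq_integral ((hH 0).1.mul_eiRe (by fun_prop)) fun t => ?_
  rw [planeIntegral_apply]
  simp only [Units.val_one, one_mul, add_assoc]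
  refine ((hH (s + t)).2).trans ?_
  simp only [mul_add, eiRe_add, mul_assoc]

theorem distConj_radonKernelA_snoc_schwartzFourier (hw : HasFourierFunction u w)
    (H : 𝓢(Fin (m + 1) → ℂ, ℂ)) (b : Fin m → ℂ) (s : ℂ) :
    distConj (radonKernelA u (Fin.snoc b s : Fin (m + 1) → ℂ)) (schwartzFourier (m + 1) H) =
      ∫ c, conj (w c) * (H (glue m (c, c • b)) * eiRe (c * s)) ∂cMeasure := by
  -- As a function of `a` with `x = (b, s)` fixed, the kernel has level sets `aₙ = s - b · y - t`:
  -- hyperplanes of slope `-b`, with the sign of `t` reversed.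
  have hH := integral_schwartzFourier_hyperplane H (-b)
  simp only [smul_neg, neg_neg] at hH
  have h1 : radonKernelA u (Fin.snoc b s : Fin (m + 1) → ℂ)
      (schwartzConj (schwartzFourier (m + 1) H)) =
      u (planeIntegral (-1) (-b) s (schwartzConj (schwartzFourier (m + 1) H))) := by
    simp only [radonKernelA, Fin.snoc_castSucc, Fin.snoc_last]
    rfl
  -- The hyperplane integral of the conjugated function is a Fourier integral with this conjugated
  -- density, since conjugating `e(c (s - t))` leaves `e(c t)` as the character in `t`.
  have h2 : Integrable (fun c => conj (H (glue m (c, c • b)) * eiRe (c * s))) cMeasure :=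
    Complex.conjCLE.toContinuousLinearMap.integrable_comp ((hH 0).1.mul_eiRe (by fun_prop))
  rw [distConj_apply, h1, hw.apply_of_eq_integral h2 fun t => ?_, ← integral_conj]
  · simp only [map_mul, Complex.conj_conj]
  rw [planeIntegral_apply]
  have h3 := congrArg conj (hH (s - t)).2
  rw [← integral_conj, ← integral_conj] at h3
  simp only [schwartzConj_apply, Units.val_neg, Units.val_one, neg_mul, one_mul,
    ← sub_eq_add_neg, add_sub_assoc]
  refine h3.trans (integral_congr_ae (Filter.Eventually.of_forall fun c => ?_))
  simp only [map_mul, mul_assoc, conj_eiRe, ← eiRe_add]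
  congr 2
  ring

theorem radonEquiv_schwartz_apply (hu : HasFourierFunction u w) (hw : IsRadonMultiplier m w)
    (f : 𝓢(Fin (m + 1) → ℂ, ℂ)) (a : Fin (m + 1) → ℂ) :
    (radonEquiv hw ⟨f, schwartz_mem_radonAlgebra f⟩ : (Fin (m + 1) → ℂ) → ℂ) a =
      radonKernelX u a f := by
  obtain ⟨H, rfl⟩ := schwartzFourier_surjective (m + 1) f
  rw [radonEquiv_apply, radonMap_eq hw _ (integrable_schwartz_comp_glue H)
    (splitFourier_schwartz H), ← Fin.snoc_init_self a, splitFourier_radonMul_schwartz hw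
    (one_mul 1), radonKernelX_snoc_schwartzFourier hu]
  simp only [one_mul]

theorem radonEquiv_symm_schwartz_apply (hu : HasFourierFunction u w)
    (hw : IsRadonMultiplier m w) (g : 𝓢(Fin (m + 1) → ℂ, ℂ)) (x : Fin (m + 1) → ℂ) :
    ((radonEquiv hw).symm ⟨g, schwartz_mem_radonAlgebra g⟩ : (Fin (m + 1) → ℂ) → ℂ) x =
      distConj (radonKernelA u x) g := by
  obtain ⟨H, rfl⟩ := schwartzFourier_surjective (m + 1) g
  rw [radonEquiv_symm_apply, radonMap_eq hw.conj _ (integrable_schwartz_comp_glue H)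
    (splitFourier_schwartz H), ← Fin.snoc_init_self x, splitFourier_radonMul_schwartz hw.conj
    neg_one_mul_neg_one, distConj_radonKernelA_snoc_schwartzFourier hu]
  simp only [neg_mul, one_mul, neg_smul, neg_neg]

/-! ### Continuity on the test spaces and the final assembly -/

theorem integral_mul_conj_eq_inner {α : Type*} [MeasurableSpace α] {μ : Measure α}
    (f g : Lp ℂ 2 μ) : ∫ x, f x * conj (g x) ∂μ = inner ℂ g f := by
  rw [L2.inner_def]
  rfl

/-- The Radon transform is a topological isomorphism of the test spaces. -/
noncomputable def radonTestEquiv (hw : IsRadonMultiplier m w) :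
    (radonTestAlgebra (radonEquiv hw).toLinearMap).carrier ≃L[ℂ]
      (radonTestAlgebra (radonEquiv hw).symm.toLinearMap).carrier :=
  { radonEquiv hw with
    continuous_toFun := by
      have hc : Continuous fun f : (radonTestAlgebra (radonEquiv hw).toLinearMap).carrier =>
        radonEmbedding (radonEquiv hw).toLinearMap f := continuous_induced_dom
      refine continuous_induced_rng.2 ?_
      -- In the embedding coordinates the transform acts by `radonL2` on the `L²` class and
      -- exchanges the two families of point values, because the target topology is built from the
      -- inverse transform. Continuity is therefore immediate.
      refine Continuous.congr (f := fun f : (radonTestAlgebra (radonEquiv hw).toLinearMap).carrier =>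
        let q := radonEmbedding (radonEquiv hw).toLinearMap f
        (radonL2 hw q.1, q.2.2, q.2.1)) ?_ fun f => ?_
      · exact ((radonL2 hw).continuous.comp (continuous_fst.comp hc)).prodMk
          ((continuous_snd.comp (continuous_snd.comp hc)).prodMk
            (continuous_fst.comp (continuous_snd.comp hc)))
      · refine Prod.ext (radonL2_toLp hw f) (Prod.ext rfl ?_)
        exact congrArg Subtype.val ((radonEquiv hw).symm_apply_apply f).symm
    continuous_invFun := by
      have hc : Continuous fun f : (radonTestAlgebra (radonEquiv hw).symm.toLinearMap).carrier =>
        radonEmbedding (radonEquiv hw).symm.toLinearMap f := continuous_induced_dom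
      refine continuous_induced_rng.2 ?_
      refine Continuous.congr
        (f := fun f : (radonTestAlgebra (radonEquiv hw).symm.toLinearMap).carrier =>
        let q := radonEmbedding (radonEquiv hw).symm.toLinearMap f
        ((radonL2 hw).symm q.1, q.2.2, q.2.1)) ?_ fun f => ?_
      · exact ((radonL2 hw).symm.continuous.comp (continuous_fst.comp hc)).prodMk
          ((continuous_snd.comp (continuous_snd.comp hc)).prodMk
            (continuous_fst.comp (continuous_snd.comp hc)))
      · refine Prod.ext ?_ (Prod.ext rfl ?_)
        -- Compatibility of the inverse with the `L²` inclusion follows from `radonL2_toLp` applied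
        -- to the preimage.
        · refine ((radonL2 hw).symm_apply_eq).2 ?_
          refine Eq.trans ?_ (radonL2_toLp hw ((radonEquiv hw).symm f)).symm
          exact congrArg (radonAlgebraToLp m) ((radonEquiv hw).apply_symm_apply f).symm
        · exact congrArg Subtype.val ((radonEquiv hw).apply_symm_apply f).symm }

theorem isGeneralizedFourierTransform_radon (hu : HasFourierFunction u w)
    (hw : IsRadonMultiplier m w) :
    IsGeneralizedFourierTransform (cnMeasure (m + 1)) (cnMeasure (m + 1))
      (radonKernelX (m := m) u) (radonKernelA (m := m) u) := by
  refine ⟨(radonL2 hw).toContinuousLinearEquiv, radonTestAlgebra (radonEquiv hw).toLinearMap,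
    radonTestAlgebra (radonEquiv hw).symm.toLinearMap, radonTestEquiv hw, fun f => ?_,
    fun f g => ?_, fun f y => ?_, fun g x => ?_⟩
  · exact radonL2_toLp hw f
  · rw [integral_mul_conj_eq_inner, integral_mul_conj_eq_inner]
    exact ((radonL2 hw).inner_map_map g f).symm
  · exact radonEquiv_schwartz_apply hu hw f y
  · exact radonEquiv_symm_schwartz_apply hu hw g x

end Kernels

theorem mainTheorem7 (m : ℕ) (u : 𝓢'(ℂ, ℂ)) (w : ℂ → ℂ)
    (hw : HasFourierFunction u w)
    (habs : ∀ᵐ c ∂(volume : Measure ℂ), ‖w c‖ = ‖c‖ ^ m) :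
    (∀ U : 𝓢'(ℂ, ℂ),
      IsFourierIntegral U (fun c => (w c)⁻¹ * (‖c‖ : ℂ) ^ (2 * m)) ↔ U = distConj u) ∧
    IsGeneralizedFourierTransform (cnMeasure (m + 1)) (cnMeasure (m + 1))
      (radonKernelX (m := m) u) (radonKernelA (m := m) u) := by
  have hm := hw.isRadonMultiplier habs
  refine ⟨fun U => ?_, isGeneralizedFourierTransform_radon hw hm⟩
  rw [isFourierIntegral_congr_ae hm.inv_mul_ae_eq]
  refine ⟨fun hU => hU.unique hw.isFourierIntegral_distConj, ?_⟩
  rintro rfl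
  exact hw.isFourierIntegral_distConj
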